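/- Let $\mathbb X_1,\dots,\mathbb X_N$ be nonempty compact Polish spaces, $\mathbb X=\prod_{i=1}^N\mathbb X_i$, and let $\mu_i,\gamma_i$ be finite non-negative Borel measures on $\mathbb X_i$, where each $\mu_i$ has full support and $\mathrm{KL}(\mu^\otimes,\gamma^\otimes)<\infty$, with $\mu^\otimes=\bigotimes_i\mu_i$ and $\gamma^\otimes=\bigotimes_i\gamma_i$. Here $\mathrm{KL}(\pi,\gamma)=\int\log\frac{d\pi}{d\gamma}\,d\pi+\gamma(\mathbb X)-\pi(\mathbb X)$ if $\pi\ll\gamma$, and $\mathrm{KL}(\pi,\gamma)=\infty$ otherwise. Let $c\in C(\mathbb X)$ be non-negative, let $\varepsilon>0$, and let $\varphi_1,\dots,\varphi_N$ be entropy functions, i.e. convex lower semi-continuous functions $\varphi_i:\mathbb R\to[0,\infty]$ with $\varphi_i(1)=0$ and $\varphi_i=\infty$ on $(-\infty,0)$. Write $(\varphi_i)'_\infty=\lim_{x\to\infty}\varphi_i(x)/x\in[0,\infty]$ and $\varphi_i^*(q)=\sup_{x\in\mathbb R}\{qx-\varphi_i(x)\}$. For finite non-negative measures $\rho,\nu$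 with Lebesgue decomposition $\rho=\sigma\nu+\rho^\perp$ put $D_{\varphi_i}(\rho,\nu)=\int\varphi_i\circ\sigma\,d\nu+(\varphi_i)'_\infty\,\rho^\perp(\mathbb X_i)$ with $0\cdot\infty=0$. Define $$\mathrm{UMOT}_\varepsilon(\mu)=\inf_{\pi\in\mathcal M^+(\mathbb X)}\int_{\mathbb X}c\,d\pi+\varepsilon\,\mathrm{KL}(\pi,\gamma^\otimes)+\sum_{i=1}^N D_{\varphi_i}(\pi_i,\mu_i),$$ where $\mathcal M^+(\mathbb X)$ is the set of finite non-negative Borel measures on $\mathbb X$ and $\pi_i$ is the $i$-th marginal of $\pi$. For $f=(f_1,\dots,f_N)\in L^{\infty,\times}(\mathbb X):=\prod_{i=1}^N L^\infty(\mathbb X_i,\gamma_i)$ let $f^\oplus(x)=\sum_i f_i(x_i)$ and $$D(f)=-\sum_{i=1}^N\int_{\mathbb X_i}\varphi_i^*(-f_i)\,d\mu_i-\varepsilon\int_{\mathbb X}\Bigl(\exp\Bigl(\frac{f^\oplus-c}{\varepsilon}\Bigr)-1\Bigr)\,d\gamma^\otimes\in[-\infty,\infty).$$ Then the following hold. (i)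 If for every $i$ we have $\gamma_i\ll\mu_i$ or $(\varphi_i)'_\infty=\infty$, then $\mathrm{UMOT}_\varepsilon(\mu)=\sup_{f\in L^{\infty,\times}(\mathbb X)}D(f)$ (as an identity in $[-\infty,\infty]$). (ii) If $\varphi_1^*,\dots,\varphi_N^*$ are strictly convex on their effective domains, then the effective domain $\{f: D(f)>-\infty\}$ is convex and $D$ is strictly concave on it. (iii) If $\hat\pi\in\mathcal M^+(\mathbb X)$ is any minimizer of the primal problem and $\hat f\in L^{\infty,\times}(\mathbb X)$ is any maximizer of $D$, then $\hat\pi=\exp\bigl(\frac{\hat f^\oplus-c}{\varepsilon}\bigr)\gamma^\otimes$. -/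

import Mathlib

open MeasureTheory Filter Set
open scoped ENNReal

noncomputable section

namespace UMOT

/-- Entropy functions: proper convex lower semicontinuous `φ : ℝ → [0, ∞]` with `φ 1 = 0` and
`φ = ∞` on `(-∞, 0)`. Non-negativity is built into the codomain, properness follows from
`φ 1 = 0`. -/
structure IsEntropyFunction (φ : ℝ → ℝ≥0∞) : Prop where
  convex : ∀ x y a b : ℝ, 0 ≤ a → 0 ≤ b → a + b = 1 →
    φ (a * x + b * y) ≤ ENNReal.ofReal a * φ x + ENNReal.ofReal b * φ y
  lsc : LowerSemicontinuous φ
  one : φ 1 = 0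
  neg : ∀ x < 0, φ x = ∞

/-- The recession constant `lim_{x → ∞} φ x / x`. It is written as an upper limit; for an entropy
function the limit exists in `[0, ∞]`. -/
def recession (φ : ℝ → ℝ≥0∞) : ℝ≥0∞ :=
  limsup (fun x : ℝ => φ x / ENNReal.ofReal x) atTop

/-- The Fenchel conjugate `φ* q = sup_x (q x - φ x)`, with values in `(-∞, ∞]` when `φ` is
proper. -/
def conj (φ : ℝ → ℝ≥0∞) (q : ℝ) : EReal :=
  ⨆ x : ℝ, ((q * x : ℝ) : EReal) - ((φ x : ℝ≥0∞) : EReal)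

/-- Strict convexity of an extended-valued function `g : ℝ → (-∞, ∞]`: strict convexity on its
effective domain. -/
def StrictlyConvex (g : ℝ → EReal) : Prop :=
  StrictConvexOn ℝ {q | g q ≠ ⊤} (fun q => (g q).toReal)

/-- The `φ`-divergence `∫ φ(σ) dν + φ'_∞ ρ^⊥(X)`, where `ρ = σ ν + ρ^⊥` is the Lebesgue
decomposition of `ρ` with respect to `ν`. In `ℝ≥0∞` we have `0 * ∞ = 0`. -/
def divergence {X : Type*} [MeasurableSpace X] (φ : ℝ → ℝ≥0∞) (ρ ν : Measure X) : ℝ≥0∞ :=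
  ∫⁻ x, φ (ρ.rnDeriv ν x).toReal ∂ν + recession φ * (ρ.singularPart ν) univ

/-- The integral of an extended-real function: integral of the positive part minus integral of the
negative part. -/
def eintegral {X : Type*} [MeasurableSpace X] (ν : Measure X) (g : X → EReal) : EReal :=
  ((∫⁻ x, (g x).toENNReal ∂ν : ℝ≥0∞) : EReal) - ((∫⁻ x, (-(g x)).toENNReal ∂ν : ℝ≥0∞) : EReal)

variable {N : ℕ} {X : Fin N → Type*} [∀ i, TopologicalSpace (X i)] [∀ i, MeasurableSpace (X i)]

/-- The primal objective
`π ↦ ∫ c dπ + ε KL(π, γ^⊗) + ∑ i, D_{φ i}(π_i, μ i)`, `π_i` the `i`-th marginal of `π`. -/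
def primal (ε : ℝ) (c : C(∀ i, X i, ℝ)) (φ : Fin N → ℝ → ℝ≥0∞) (μ γ : ∀ i, Measure (X i))
    [∀ i, IsFiniteMeasure (γ i)] (π : FiniteMeasure (∀ i, X i)) : EReal :=
  ((∫ x, c x ∂(π : Measure (∀ i, X i)) : ℝ) : EReal) +
    ((ENNReal.ofReal ε * InformationTheory.klDiv (π : Measure (∀ i, X i)) (Measure.pi γ) +
      ∑ i, divergence (φ i) ((π : Measure (∀ i, X i)).map (fun x => x i)) (μ i) : ℝ≥0∞) : EReal)

/-- The value of the regularized unbalanced multi-marginal optimal transport problem. -/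
def value (ε : ℝ) (c : C(∀ i, X i, ℝ)) (φ : Fin N → ℝ → ℝ≥0∞) (μ γ : ∀ i, Measure (X i))
    [∀ i, IsFiniteMeasure (γ i)] : EReal :=
  ⨅ π : FiniteMeasure (∀ i, X i), primal ε c φ μ γ π

/-- The function `exp((f^⊕ - c) / ε)`, where `f^⊕ x = ∑ i, f i (x i)`. -/
def gibbs (ε : ℝ) (c : C(∀ i, X i, ℝ)) {γ : ∀ i, Measure (X i)} (f : ∀ i, Lp ℝ ∞ (γ i))
    (x : ∀ i, X i) : ℝ :=
  Real.exp (((∑ i, f i (x i)) - c x) / ε)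

/-- The dual functional
`f ↦ -∑ i, ⟨μ i, φ i* (-f i)⟩ - ε ⟨γ^⊗, exp((f^⊕ - c) / ε) - 1⟩` on `∏ i, L^∞(X i, γ i)`. -/
def dual (ε : ℝ) (c : C(∀ i, X i, ℝ)) (φ : Fin N → ℝ → ℝ≥0∞) (μ γ : ∀ i, Measure (X i))
    [∀ i, IsFiniteMeasure (γ i)] (f : ∀ i, Lp ℝ ∞ (γ i)) : EReal :=
  -(∑ i, eintegral (μ i) (fun x => conj (φ i) (-(f i x)))) -
    ((ε * ∫ x, (gibbs ε c f x - 1) ∂(Measure.pi γ) : ℝ) : EReal)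

end UMOT

end

/-!
# Duality for entropy-regularized unbalanced multi-marginal optimal transport

Write a competitor of the primal problem as `π = p γ^⊗`, and give its marginals densities `r i` with
respect to `μ i`. Once the constraint "the `i`-th marginal of `p γ^⊗` is `r i μ i`" is dropped, the
objective becomes a convex functional `cost` of the independent variables `p` and `r`, and the dual
functional is the Lagrangian dual for this constraint, with multipliers in
`L^∞(γ i) = L^1(γ i)^*`.

*Weak duality* (`dual_add_hellinger_le_primal`). The marginal terms are handled by the
Fenchel–Young inequality; this is where `γ i ≪ μ i` or an infinite recession constant is needed, to
rule out the singular part of the marginal. The remaining terms combine to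
`ε ∫ (p log p - p log g - p + g) dγ^⊗` with `g = exp((f^⊕ - c) / ε)`. By the elementary inequality
`sq_sqrt_sub_sqrt_le` this is at least `ε ∫ (√p - √g)² dγ^⊗`, so the duality gap controls the
Hellinger distance between `π` and the Gibbs measure of `f`.

*Strong duality* (`value_le_iSup_dual`). Let `α` be smaller than the primal value. The same
elementary inequality shows that `cost` is strongly convex in `p` for the Hellinger distance.
Near-minimizers of the problems with relaxed constraints are therefore Cauchy in `L^1`, and their
limit is feasible (`exists_feasible_of_relaxed`). Hence `cost ≥ α` persists for pairs `(p, r)` whose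
constraint violation is small in `L^1`. The Hahn–Banach theorem separates the convex set of pairs
(violation, cost) from the product of a ball and a half-line (`exists_multipliers`), and
`exists_bounded_repr_L1` represents the separating functional by bounded functions. Evaluating the
resulting lower bound for the Lagrangian at the Gibbs density and at measurable near-maximizers in
the definition of `φ i*` gives a potential `f` with `dual f ≥ α` (`exists_le_dual_of_multipliers`).

*Strict concavity* (`strictConcaveOn_dual`). If `f i` and `g i` differ on a set charged by `μ i`,
strictness comes from `φ i*`. Otherwise `f^⊕` and `g^⊕` differ on a box of positive `γ^⊗`-measure,
because `μ j ≪ γ j`, and strictness comes from the exponential.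

*Optimality.* The existence of a maximizer of the dual functional forces `γ i ≪ μ i`
(`absolutelyContinuous_of_isMax`), so there is no duality gap, and the Hellinger distance between a
minimizer and the Gibbs measure of a maximizer vanishes.
-/

namespace UMOT

/-! ### Strong convexity of the entropy -/

/-- A lower bound for the Bregman divergence of `x log x` by the squared Hellinger distance. It
follows from `log y ≤ y - 1` at `y = √m / √x`. -/
theorem sq_sqrt_sub_sqrt_le {x m : ℝ} (hx : 0 ≤ x) (hm : 0 < m) :
    (√x - √m) ^ 2 ≤ x * Real.log x - x * Real.log m - x + m := by
  rcases hx.eq_or_lt with rfl | hx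
  · simp [Real.sq_sqrt hm.le]
  have hsx : 0 < √x := Real.sqrt_pos.2 hx
  have hsm : 0 < √m := Real.sqrt_pos.2 hm
  have h1 : Real.log (√m / √x) ≤ √m / √x - 1 := Real.log_le_sub_one_of_pos (by positivity)
  rw [Real.log_div hsm.ne' hsx.ne', Real.log_sqrt hm.le, Real.log_sqrt hx.le] at h1
  have h2 := mul_le_mul_of_nonneg_left h1 hx.le
  have h3 : x * (√m / √x) = √x * √m := by
    nth_rewrite 1 [← Real.mul_self_sqrt hx.le]
    field_simp
  have h4 := Real.sq_sqrt hx.le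
  have h5 := Real.sq_sqrt hm.le
  nlinarith

/-- The entropy is strongly convex with respect to the Hellinger distance. -/
theorem klFun_strongly_convex {x y a b : ℝ} (hx : 0 ≤ x) (hy : 0 ≤ y) (ha : 0 ≤ a) (hb : 0 ≤ b)
    (hab : a + b = 1) :
    InformationTheory.klFun (a * x + b * y) + a * b * (√x - √y) ^ 2 ≤
      a * InformationTheory.klFun x + b * InformationTheory.klFun y := by
  rcases ha.eq_or_lt with rfl | ha
  · obtain rfl : b = 1 := by linarith
    simp
  rcases hb.eq_or_lt with rfl | hb
  · obtain rfl : a = 1 := by linarith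
    simp
  have hax := mul_nonneg ha.le hx
  have hby := mul_nonneg hb.le hy
  rcases (add_nonneg hax hby).eq_or_lt with h0 | hm
  · have hx0 : x = 0 := by
      rcases mul_eq_zero.1 (show a * x = 0 by linarith) with h | h
      · exact absurd h ha.ne'
      · exact h
    have hy0 : y = 0 := by
      rcases mul_eq_zero.1 (show b * y = 0 by linarith) with h | h
      · exact absurd h hb.ne'
      · exact h
    subst hx0 hy0
    simp [InformationTheory.klFun]
    linarith
  · set m := a * x + b * y with hmdef
    have h1 := mul_le_mul_of_nonneg_left (sq_sqrt_sub_sqrt_le hx hm) ha.le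
    have h2 := mul_le_mul_of_nonneg_left (sq_sqrt_sub_sqrt_le hy hm) hb.le
    -- `min (a u² + b v²)` subject to `u - v = d` equals `a b d²`
    have h3 : a * b * (√x - √y) ^ 2 ≤ a * (√x - √m) ^ 2 + b * (√y - √m) ^ 2 := by
      obtain rfl : b = 1 - a := by linarith
      nlinarith [sq_nonneg (a * (√x - √m) + (1 - a) * (√y - √m))]
    have h4 : m * Real.log m = a * (x * Real.log m) + b * (y * Real.log m) := by
      rw [hmdef]; ring
    simp only [InformationTheory.klFun]
    have h5 : (a + b) * m = m := by rw [hab, one_mul]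
    nlinarith

/-- The entropy controls the mass. -/
theorem le_two_mul_klFun_add_two {x : ℝ} (hx : 0 ≤ x) :
    x ≤ 2 * InformationTheory.klFun x + 2 := by
  have h := sq_sqrt_sub_sqrt_le hx one_pos
  simp only [Real.log_one, mul_zero, sub_zero, Real.sqrt_one] at h
  simp only [InformationTheory.klFun]
  nlinarith [Real.sq_sqrt hx, sq_nonneg (√x - 2)]

/-! ### The conjugate of an entropy function -/

theorem le_conj {φ : ℝ → ℝ≥0∞} (h1 : φ 1 = 0) (q : ℝ) : (q : EReal) ≤ conj φ q := by
  refine le_iSup_of_le 1 ?_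
  simp [h1]

theorem conj_ne_bot {φ : ℝ → ℝ≥0∞} (h1 : φ 1 = 0) (q : ℝ) : conj φ q ≠ ⊥ :=
  ((EReal.bot_lt_coe q).trans_le (le_conj h1 q)).ne'

/-- The Fenchel–Young inequality. -/
theorem mul_le_toReal_add_conj {φ : ℝ → ℝ≥0∞} (h1 : φ 1 = 0) {x q : ℝ} (hx : φ x ≠ ∞)
    (hq : conj φ q ≠ ⊤) : q * x ≤ (φ x).toReal + (conj φ q).toReal := by
  have h : ((q * x : ℝ) : EReal) - ((φ x : ℝ≥0∞) : EReal) ≤ conj φ q :=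
    le_iSup (fun x : ℝ => ((q * x : ℝ) : EReal) - ((φ x : ℝ≥0∞) : EReal)) x
  rw [← EReal.coe_toReal hq (conj_ne_bot h1 q), ← EReal.coe_ennreal_toReal hx,
    ← EReal.coe_sub, EReal.coe_le_coe_iff] at h
  linarith

/-- The conjugate is a supremum of countably many affine functions, the first of which is the
identity. -/
theorem exists_seq_conj_eq_iSup {φ : ℝ → ℝ≥0∞} (h1 : φ 1 = 0) :
    ∃ x : ℕ → ℝ, x 0 = 1 ∧ (∀ n, φ (x n) ≠ ∞) ∧
      ∀ q, conj φ q = ⨆ n, ((q * x n - (φ (x n)).toReal : ℝ) : EReal) := by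
  let S : Set (ℝ × ℝ) := {z | φ z.1 ≠ ∞ ∧ z.2 = (φ z.1).toReal}
  have : Nonempty S := ⟨⟨(1, 0), by simp [S, h1]⟩⟩
  -- a sequence that is dense in the graph of `φ`
  obtain ⟨u, hu⟩ := TopologicalSpace.exists_dense_seq S
  let x : ℕ → ℝ := fun n => Nat.casesOn n 1 (fun k => (u k).1.1)
  have hx : ∀ n, φ (x n) ≠ ∞ := by
    rintro (_ | n)
    · simp [x, h1]
    · exact (u n).2.1
  have key : ∀ q y : ℝ, φ y ≠ ∞ →
      ((q * y : ℝ) : EReal) - ((φ y : ℝ≥0∞) : EReal) = ((q * y - (φ y).toReal : ℝ) : EReal) := by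
    intro q y hy
    rw [EReal.coe_sub, EReal.coe_ennreal_toReal hy]
  refine ⟨x, rfl, hx, fun q => le_antisymm (iSup_le fun y => ?_) (iSup_le fun n => ?_)⟩
  · by_cases hy : φ y = ∞
    · simp [hy]
    rw [key q y hy]
    refine le_of_forall_lt fun d hd => ?_
    obtain ⟨e, hde, hey⟩ := EReal.lt_iff_exists_real_btwn.1 hd
    have hey' : e < q * y - (φ y).toReal := by exact_mod_cast hey
    have hopen : IsOpen {s : S | e < q * s.1.1 - s.1.2} :=
      isOpen_lt continuous_const (by fun_prop)
    obtain ⟨n, hn⟩ := hu.exists_mem_open hopen ⟨⟨(y, (φ y).toReal), hy, rfl⟩, hey'⟩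
    refine lt_of_lt_of_le (hde.trans ?_)
      (le_iSup (fun n => ((q * x n - (φ (x n)).toReal : ℝ) : EReal)) (n + 1))
    have h2 : e < q * (u n).1.1 - (u n).1.2 := hn
    rw [(u n).2.2] at h2
    exact_mod_cast h2
  · rw [← key q _ (hx n)]
    exact le_iSup (fun x : ℝ => ((q * x : ℝ) : EReal) - ((φ x : ℝ≥0∞) : EReal)) (x n)

theorem measurable_conj {φ : ℝ → ℝ≥0∞} (h1 : φ 1 = 0) : Measurable (conj φ) := by
  obtain ⟨x, -, -, h⟩ := exists_seq_conj_eq_iSup h1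
  rw [show conj φ = fun q => ⨆ n, ((q * x n - (φ (x n)).toReal : ℝ) : EReal) from funext h]
  exact Measurable.iSup fun n => Measurable.coe_real_ereal (by fun_prop)

/-- Measurable, finitely valued near-maximizers in the definition of the conjugate, whose values
increase to the conjugate. -/
theorem exists_selection {φ : ℝ → ℝ≥0∞} (hφ : IsEntropyFunction φ) :
    ∃ R : ℕ → ℝ → ℝ, (∀ n, Measurable (R n)) ∧ (∀ n, (range (R n)).Finite) ∧
      (∀ n q, φ (R n q) ≠ ∞) ∧ (∀ n q, 0 ≤ R n q) ∧
      (∀ q, Monotone fun n => q * R n q - (φ (R n q)).toReal) ∧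
      (∀ n q, q ≤ q * R n q - (φ (R n q)).toReal) ∧
      ∀ q, conj φ q = ⨆ n, ((q * R n q - (φ (R n q)).toReal : ℝ) : EReal) := by
  obtain ⟨x, hx0, hx, hc⟩ := exists_seq_conj_eq_iSup hφ.one
  have hnn : ∀ y, φ y ≠ ∞ → 0 ≤ y := fun y hy => by
    by_contra h
    exact hy (hφ.neg y (not_le.1 h))
  let R : ℕ → ℝ → ℝ := fun n => Nat.rec (fun _ => 1) (fun k Rk q =>
    if q * Rk q - (φ (Rk q)).toReal < q * x (k + 1) - (φ (x (k + 1))).toReal then x (k + 1)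
      else Rk q) n
  have hsucc : ∀ n q, R (n + 1) q =
      if q * R n q - (φ (R n q)).toReal < q * x (n + 1) - (φ (x (n + 1))).toReal then x (n + 1)
        else R n q := fun n q => rfl
  have hmφ : Measurable φ := hφ.lsc.measurable
  have hmem : ∀ n q, ∃ k, R n q = x k := by
    intro n
    induction n with
    | zero => exact fun q => ⟨0, hx0.symm⟩
    | succ n ih =>
      intro q
      rw [hsucc]
      split_ifs
      · exact ⟨_, rfl⟩
      · exact ih q
  have hstep : ∀ n q, q * R n q - (φ (R n q)).toReal ≤
      q * R (n + 1) q - (φ (R (n + 1) q)).toReal := by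
    intro n q
    rw [hsucc]
    split_ifs with h
    · exact h.le
    · exact le_rfl
  have hmono : ∀ q, Monotone fun n => q * R n q - (φ (R n q)).toReal :=
    fun q => monotone_nat_of_le_succ fun n => hstep n q
  have hfin : ∀ n q, φ (R n q) ≠ ∞ := fun n q => by
    obtain ⟨k, hk⟩ := hmem n q
    rw [hk]; exact hx k
  refine ⟨R, ?_, ?_, hfin, fun n q => hnn _ (hfin n q), hmono, ?_, ?_⟩
  · intro n
    induction n with
    | zero => exact measurable_const
    | succ n ih =>
      rw [show R (n + 1) = _ from funext (hsucc n)]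
      refine Measurable.ite ?_ measurable_const ih
      exact measurableSet_lt
        ((measurable_id.mul ih).sub (hmφ.comp ih).ennreal_toReal) (by fun_prop)
  · intro n
    induction n with
    | zero => exact finite_range_const
    | succ n ih =>
      refine (ih.union (finite_singleton (x (n + 1)))).subset ?_
      rintro _ ⟨q, rfl⟩
      rw [hsucc]
      split_ifs
      · exact Or.inr rfl
      · exact Or.inl ⟨q, rfl⟩
  · intro n q
    refine le_trans ?_ (hmono q (Nat.zero_le n))
    simp [R, hφ.one]
  · intro q
    refine le_antisymm ?_ (iSup_le fun n => ?_)
    · rw [hc]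
      refine iSup_le fun n => ?_
      refine le_iSup_of_le n ?_
      rw [EReal.coe_le_coe_iff]
      cases n with
      | zero => simp [R, hx0]
      | succ n =>
        rw [hsucc]
        split_ifs with h
        · exact le_rfl
        · exact not_lt.1 h
    · obtain ⟨k, hk⟩ := hmem n q
      rw [hc, hk]
      exact le_iSup (fun n => ((q * x n - (φ (x n)).toReal : ℝ) : EReal)) k

/-! ### The extended integral -/

section EIntegral

variable {Y : Type*} [MeasurableSpace Y] {ν : Measure Y} {g : Y → EReal}

/-- For an almost everywhere finite integrable function, the extended integral is the Bochner
integral, with no `∞ - ∞` involved. -/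
theorem eintegral_eq_integral (hg : ∀ᵐ y ∂ν, g y ≠ ⊤ ∧ g y ≠ ⊥)
    (hint : Integrable (fun y => (g y).toReal) ν) :
    eintegral ν g = ((∫ y, (g y).toReal ∂ν : ℝ) : EReal) := by
  have h1 : ∫⁻ y, (g y).toENNReal ∂ν = ∫⁻ y, ENNReal.ofReal (g y).toReal ∂ν :=
    lintegral_congr_ae (hg.mono fun y hy => EReal.toENNReal_of_ne_top hy.1)
  have h2 : ∫⁻ y, (-(g y)).toENNReal ∂ν = ∫⁻ y, ENNReal.ofReal (-(g y).toReal) ∂ν := by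
    refine lintegral_congr_ae (hg.mono fun y hy => ?_)
    change (-(g y)).toENNReal = _
    rw [EReal.toENNReal_of_ne_top (by simpa using hy.2), EReal.toReal_neg_eq]
  have h3 := hint.lintegral_lt_top.ne
  have h4 := hint.neg.lintegral_lt_top.ne
  simp only [Pi.neg_apply] at h4
  rw [eintegral, h1, h2, integral_eq_lintegral_pos_part_sub_lintegral_neg_part hint,
    EReal.coe_sub, EReal.coe_ennreal_toReal h3, EReal.coe_ennreal_toReal h4]

theorem eintegral_ne_bot (hneg : ∫⁻ y, (-(g y)).toENNReal ∂ν ≠ ∞) : eintegral ν g ≠ ⊥ := by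
  rw [eintegral, ← EReal.coe_ennreal_toReal hneg, sub_eq_add_neg, ← EReal.coe_neg]
  intro h
  rcases EReal.add_eq_bot_iff.1 h with h | h
  · exact EReal.coe_ennreal_ne_bot _ h
  · exact EReal.coe_ne_bot _ h

theorem integrable_of_lintegral_ne_top (hg : Measurable g)
    (hpos : ∫⁻ y, (g y).toENNReal ∂ν ≠ ∞) (hneg : ∫⁻ y, (-(g y)).toENNReal ∂ν ≠ ∞) :
    (∀ᵐ y ∂ν, g y ≠ ⊤ ∧ g y ≠ ⊥) ∧ Integrable (fun y => (g y).toReal) ν := by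
  have hae : ∀ᵐ y ∂ν, g y ≠ ⊤ ∧ g y ≠ ⊥ := by
    filter_upwards [ae_lt_top hg.ereal_toENNReal hpos, ae_lt_top hg.neg.ereal_toENNReal hneg]
      with y h1 h2
    constructor
    · intro h
      simp [h] at h1
    · intro h
      simp [h] at h2
  refine ⟨hae, hg.ereal_toReal.aestronglyMeasurable, ?_⟩
  rw [hasFiniteIntegral_iff_enorm]
  refine lt_of_le_of_lt (lintegral_mono_ae
    (g := fun y => (g y).toENNReal + (-(g y)).toENNReal) ?_) ?_
  · refine hae.mono fun y hy => ?_
    rw [EReal.toENNReal_of_ne_top hy.1, EReal.toENNReal_of_ne_top (by simpa using hy.2),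
      EReal.toReal_neg_eq, Real.enorm_eq_ofReal_abs]
    rcases le_total 0 (g y).toReal with h | h
    · rw [abs_of_nonneg h]; exact le_self_add
    · rw [abs_of_nonpos h]; exact le_add_self
  · rw [lintegral_add_left hg.ereal_toENNReal]
    exact ENNReal.add_lt_top.2 ⟨hpos.lt_top, hneg.lt_top⟩

theorem integrable_of_eintegral_ne_top (hg : Measurable g)
    (hneg : ∫⁻ y, (-(g y)).toENNReal ∂ν ≠ ∞) (h : eintegral ν g ≠ ⊤) :
    (∀ᵐ y ∂ν, g y ≠ ⊤ ∧ g y ≠ ⊥) ∧ Integrable (fun y => (g y).toReal) ν := by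
  refine integrable_of_lintegral_ne_top hg (fun h' => h ?_) hneg
  rw [eintegral, h', ← EReal.coe_ennreal_toReal hneg]
  simp

/-- If integrable functions increase to `g` and their integrals are bounded, then `g` is
integrable and the integrals converge. -/
theorem tendsto_integral_eintegral {V : ℕ → Y → ℝ} {b : ℝ} [IsFiniteMeasure ν]
    (hV : ∀ n, Measurable (V n)) (hVint : ∀ n, Integrable (V n) ν)
    (hmono : ∀ᵐ y ∂ν, Monotone fun n => V n y) (hb : ∀ n, ∫ y, V n y ∂ν ≤ b)
    (hsup : ∀ᵐ y ∂ν, g y = ⨆ n, (V n y : EReal)) (hg : Measurable g) :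
    Tendsto (fun n => ((∫ y, V n y ∂ν : ℝ) : EReal)) atTop (nhds (eintegral ν g)) ∧
      eintegral ν g ≠ ⊤ := by
  have hle : ∀ᵐ y ∂ν, ∀ n, (V n y : EReal) ≤ g y := by
    filter_upwards [hsup] with y hy n
    rw [hy]; exact le_iSup (fun n => (V n y : EReal)) n
  have hneg : ∫⁻ y, (-(g y)).toENNReal ∂ν ≠ ∞ := by
    refine ne_top_of_le_ne_top (hVint 0).neg.lintegral_lt_top.ne (lintegral_mono_ae ?_)
    filter_upwards [hle] with y hy
    have h := EReal.toENNReal_le_toENNReal (EReal.neg_le_neg_iff.2 (hy 0))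
    rwa [← EReal.coe_neg, EReal.toENNReal_of_ne_top (EReal.coe_ne_top _),
      EReal.toReal_coe] at h
  have hpos : ∫⁻ y, (g y).toENNReal ∂ν ≠ ∞ := by
    have h1 : ∫⁻ y, (g y).toENNReal ∂ν = ∫⁻ y, ⨆ n, ENNReal.ofReal (V n y) ∂ν := by
      refine lintegral_congr_ae ?_
      filter_upwards [hsup, hmono] with y hy hm
      have ht : Tendsto (fun n => (V n y : EReal)) atTop (nhds (g y)) := by
        rw [hy]
        exact tendsto_atTop_iSup fun i j hij => EReal.coe_le_coe_iff.2 (hm hij)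
      have ht2 := (EReal.continuous_toENNReal.tendsto _).comp ht
      refine tendsto_nhds_unique ht2 ?_
      have : (EReal.toENNReal ∘ fun n => (V n y : EReal)) = fun n => ENNReal.ofReal (V n y) := by
        funext n
        simp
      rw [this]
      exact tendsto_atTop_iSup fun i j hij => ENNReal.ofReal_le_ofReal (hm hij)
    rw [h1, lintegral_iSup' (fun n => (hV n).ennreal_ofReal.aemeasurable)
      (hmono.mono fun y hy i j hij => ENNReal.ofReal_le_ofReal (hy hij))]
    refine ne_top_of_le_ne_top (b := ENNReal.ofReal (b + ∫ y, |V 0 y| ∂ν))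
      ENNReal.ofReal_ne_top (iSup_le fun n => ?_)
    have h2 : ∀ᵐ y ∂ν, ENNReal.ofReal (V n y) ≤ ENNReal.ofReal (V n y + |V 0 y|) :=
      ae_of_all _ fun y => ENNReal.ofReal_le_ofReal (by linarith [abs_nonneg (V 0 y)])
    refine (lintegral_mono_ae h2).trans ?_
    have h4 : Integrable (fun y => V n y + |V 0 y|) ν := (hVint n).add (hVint 0).abs
    rw [← ofReal_integral_eq_lintegral_ofReal h4 ?_]
    · refine ENNReal.ofReal_le_ofReal ?_
      rw [integral_add (hVint n) (hVint 0).abs]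
      linarith [hb n]
    · filter_upwards [hmono] with y hm
      have := hm (Nat.zero_le n)
      have h3 := neg_abs_le (V 0 y)
      simp only [Pi.zero_apply]
      simp only at this
      linarith
  obtain ⟨hfin, hint⟩ := integrable_of_lintegral_ne_top hg hpos hneg
  rw [eintegral_eq_integral hfin hint]
  refine ⟨(continuous_coe_real_ereal.tendsto _).comp
    (integral_tendsto_of_tendsto_of_monotone hVint hint hmono ?_), EReal.coe_ne_top _⟩
  filter_upwards [hfin, hsup, hmono] with y hy hs hm
  have ht : Tendsto (fun n => (V n y : EReal)) atTop (nhds (g y)) := by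
    rw [hs]
    exact tendsto_atTop_iSup fun i j hij => EReal.coe_le_coe_iff.2 (hm hij)
  rw [← EReal.coe_toReal hy.1 hy.2] at ht
  exact EReal.tendsto_coe.1 ht

end EIntegral

/-! ### The dual of `L¹` -/

/-- A continuous linear functional on `L¹` of a finite measure is integration against a bounded
measurable function. Its restriction to `L²` has a Riesz representative, and testing with
indicators shows that the representative is essentially bounded. -/
theorem exists_bounded_repr_L1 {Y : Type*} [MeasurableSpace Y] {ν : Measure Y}
    [IsFiniteMeasure ν] (F : Lp ℝ 1 ν →L[ℝ] ℝ) :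
    ∃ g : Y → ℝ, Measurable g ∧ (∀ y, |g y| ≤ ‖F‖) ∧ ∀ z : Lp ℝ 1 ν, F z = ∫ y, g y * z y ∂ν := by
  let T : Lp ℝ 2 ν →L[ℝ] Lp ℝ 1 ν :=
    (ContinuousLinearMap.mul ℝ ℝ).holderL ν 2 2 1 (Lp.const 2 ν 1)
  have hT : ∀ h : Lp ℝ 2 ν, T h =ᵐ[ν] h := by
    intro h
    have h1 := (ContinuousLinearMap.mul ℝ ℝ).coeFn_holder (r := 1) (Lp.const 2 ν (1 : ℝ)) h
    filter_upwards [h1, Lp.coeFn_const (p := 2) (μ := ν) (1 : ℝ)] with y h2 h3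
    rw [show T h = (ContinuousLinearMap.mul ℝ ℝ).holder 1 (Lp.const 2 ν (1 : ℝ)) h from rfl, h2, h3]
    simp
  let k : Lp ℝ 2 ν := (InnerProductSpace.toDual ℝ (Lp ℝ 2 ν)).symm (F.comp T)
  have hkint : Integrable k ν := (Lp.memLp k).integrable (by norm_num)
  have hind : ∀ s (hs : MeasurableSet s),
      F (indicatorConstLp 1 hs (measure_ne_top ν s) 1) = ∫ y in s, k y ∂ν := by
    intro s hs
    have h1 : inner ℝ k (indicatorConstLp 2 hs (measure_ne_top ν s) (1 : ℝ)) =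
        F (T (indicatorConstLp 2 hs (measure_ne_top ν s) 1)) :=
      InnerProductSpace.toDual_symm_apply
    rw [real_inner_comm, L2.inner_indicatorConstLp_one] at h1
    rw [h1]
    congr 1
    refine Lp.ext ?_
    filter_upwards [hT (indicatorConstLp 2 hs (measure_ne_top ν s) 1),
      indicatorConstLp_coeFn (p := 1) (hs := hs) (hμs := measure_ne_top ν s) (c := (1 : ℝ)),
      indicatorConstLp_coeFn (p := 2) (hs := hs) (hμs := measure_ne_top ν s) (c := (1 : ℝ))]
      with y h1 h2 h3
    rw [h1, h2, h3]
  have hbound : ∀ s (_ : MeasurableSet s), |∫ y in s, k y ∂ν| ≤ ‖F‖ * ν.real s := by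
    intro s hs
    rw [← hind s hs, ← Real.norm_eq_abs]
    refine (F.le_opNorm _).trans (le_of_eq ?_)
    rw [norm_indicatorConstLp one_ne_zero ENNReal.one_ne_top]
    simp
  have hup : k ≤ᵐ[ν] fun _ => ‖F‖ := by
    refine ae_le_of_forall_setIntegral_le hkint (integrable_const _) fun s hs _ => ?_
    rw [setIntegral_const, smul_eq_mul, mul_comm]
    exact (le_abs_self _).trans (hbound s hs)
  have hlo : (fun _ => -‖F‖) ≤ᵐ[ν] k := by
    refine ae_le_of_forall_setIntegral_le (integrable_const _) hkint fun s hs _ => ?_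
    rw [setIntegral_const, smul_eq_mul, mul_comm, neg_mul]
    exact neg_le_of_abs_le (hbound s hs)
  have hkm := (Lp.aestronglyMeasurable k).aemeasurable
  let g : Y → ℝ := fun y => max (-‖F‖) (min ‖F‖ (hkm.mk k y))
  have hgm : Measurable g := by
    have := hkm.measurable_mk
    fun_prop
  have hgk : g =ᵐ[ν] k := by
    filter_upwards [hup, hlo, hkm.ae_eq_mk] with y h1 h2 h3
    simp only [g]
    rw [← h3, min_eq_right h1, max_eq_right h2]
  have hgb : ∀ y, |g y| ≤ ‖F‖ := fun y =>
    abs_le.2 ⟨le_max_left _ _, max_le (by linarith [norm_nonneg F]) (min_le_left _ _)⟩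
  have hgLp : MemLp g ∞ ν :=
    memLp_top_of_bound hgm.aestronglyMeasurable ‖F‖ (ae_of_all _ hgb)
  let P : Lp ℝ 1 ν →L[ℝ] ℝ :=
    (ContinuousLinearMap.mul ℝ ℝ).lpPairing ν ∞ 1 (hgLp.toLp g)
  have hP : ∀ z, P z = ∫ y, g y * z y ∂ν := by
    intro z
    rw [show P z = _ from ContinuousLinearMap.lpPairing_eq_integral _ _ _]
    refine integral_congr_ae ?_
    filter_upwards [hgLp.coeFn_toLp] with y hy
    simp [hy]
  refine ⟨g, hgm, hgb, fun z => ?_⟩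
  rw [← hP]
  refine Lp.induction ENNReal.one_ne_top (motive := fun z => F z = P z) ?_ ?_ ?_ z
  · intro c s hs hμs
    have h1 : ((Lp.simpleFunc.indicatorConst 1 hs hμs.ne c : Lp.simpleFunc ℝ 1 ν) : Lp ℝ 1 ν) =
        c • indicatorConstLp 1 hs (measure_ne_top ν s) 1 := by
      rw [Lp.simpleFunc.coe_indicatorConst]
      refine Lp.ext ?_
      filter_upwards [Lp.coeFn_smul c (indicatorConstLp 1 hs (measure_ne_top ν s) (1 : ℝ)),
        indicatorConstLp_coeFn (p := 1) (hs := hs) (hμs := measure_ne_top ν s) (c := (1 : ℝ)),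
        indicatorConstLp_coeFn (p := 1) (hs := hs) (hμs := hμs.ne) (c := c)] with y h1 h2 h3
      rw [h1, h3, Pi.smul_apply, h2]
      by_cases hy : y ∈ s <;> simp [hy]
    rw [h1, map_smul, map_smul, hind, hP]
    congr 1
    rw [← integral_indicator hs]
    refine integral_congr_ae ?_
    filter_upwards [hgk, indicatorConstLp_coeFn (p := 1) (hs := hs)
      (hμs := measure_ne_top ν s) (c := (1 : ℝ))] with y h2 h3
    rw [h3, h2]
    by_cases hy : y ∈ s <;> simp [hy]
  · intro f g hf hg _ h1 h2
    rw [map_add, map_add, h1, h2]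
  · exact isClosed_eq F.continuous P.continuous

/-! ### Convergence in `L¹` -/

section L1

variable {Y : Type*} [MeasurableSpace Y] {ν : Measure Y}

/-- A fast Cauchy sequence of nonnegative functions in `L¹` converges almost everywhere, and
weakly against bounded functions. -/
theorem exists_limit_of_fast_cauchy {f : ℕ → Y → ℝ} (hf : ∀ n, Measurable (f n))
    (hf0 : ∀ n y, 0 ≤ f n y) (hfi : ∀ n, Integrable (f n) ν)
    (hc : ∀ N n m : ℕ, N ≤ n → N ≤ m → eLpNorm (f n - f m) 1 ν < (2⁻¹ : ℝ≥0∞) ^ N) :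
    ∃ F : Y → ℝ, Measurable F ∧ (∀ y, 0 ≤ F y) ∧ Integrable F ν ∧
      (∀ᵐ y ∂ν, Tendsto (fun n => f n y) atTop (nhds (F y))) ∧
      ∀ g : Y → ℝ, Measurable g → (∀ y, |g y| ≤ 1) →
        Tendsto (fun n => ∫ y, g y * f n y ∂ν) atTop (nhds (∫ y, g y * F y ∂ν)) := by
  have hB : ∑' i : ℕ, (2⁻¹ : ℝ≥0∞) ^ i ≠ ∞ := by
    rw [ENNReal.tsum_geometric]; simp
  have hm : ∀ n, AEStronglyMeasurable (f n) ν := fun n => (hf n).aestronglyMeasurable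
  obtain ⟨G, hG, hGlim⟩ := exists_stronglyMeasurable_limit_of_tendsto_ae hm
    (Lp.ae_tendsto_of_cauchy_eLpNorm hm le_rfl hB hc)
  have hF : ∀ᵐ y ∂ν, Tendsto (fun n => f n y) atTop (nhds (max 0 (G y))) := by
    filter_upwards [hGlim] with y hy
    rwa [max_eq_right (ge_of_tendsto' hy fun n => hf0 n y)]
  have hlim := Lp.cauchy_tendsto_of_tendsto hm _ hB hc hF
  have hFm : Measurable fun y => max 0 (G y) := by
    have := hG.measurable
    fun_prop
  have hFi : Integrable (fun y => max 0 (G y)) ν := by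
    obtain ⟨n, hn⟩ := (hlim.eventually (gt_mem_nhds ENNReal.zero_lt_top)).exists
    have h1 : MemLp (f n - fun y => max 0 (G y)) 1 ν :=
      ⟨(hm n).sub hFm.aestronglyMeasurable, hn⟩
    have h2 := (hfi n).sub (memLp_one_iff_integrable.1 h1)
    simpa using h2
  refine ⟨_, hFm, fun y => le_max_left _ _, hFi, hF, fun g hg hg1 => ?_⟩
  refine tendsto_integral_of_L1 _
    (hFi.bdd_mul hg.aestronglyMeasurable (ae_of_all _ hg1)).aestronglyMeasurable
    (Eventually.of_forall fun n => (hfi n).bdd_mul hg.aestronglyMeasurable (ae_of_all _ hg1)) ?_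
  refine tendsto_of_tendsto_of_tendsto_of_le_of_le tendsto_const_nhds hlim
    (fun n => zero_le) fun n => ?_
  rw [eLpNorm_one_eq_lintegral_enorm]
  refine lintegral_mono fun y => ?_
  rw [← mul_sub, enorm_mul]
  refine (mul_le_mul_left (b := ‖g y‖ₑ) (c := 1) ?_ _).trans (by simp)
  rw [Real.enorm_eq_ofReal_abs]
  exact ENNReal.ofReal_le_one.2 (hg1 y)

/-- The `L¹` distance is controlled by the squared Hellinger distance and the masses. -/
theorem lintegral_abs_sub_le {p q : Y → ℝ} (hp : Measurable p) (hq : Measurable q)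
    (hp0 : ∀ y, 0 ≤ p y) (hq0 : ∀ y, 0 ≤ q y) {K : ℝ} (hK : 0 < K) :
    ∫⁻ y, ENNReal.ofReal |p y - q y| ∂ν ≤
      ENNReal.ofReal K * ∫⁻ y, ENNReal.ofReal ((√(p y) - √(q y)) ^ 2) ∂ν +
        ENNReal.ofReal K⁻¹ * (∫⁻ y, ENNReal.ofReal (p y) ∂ν + ∫⁻ y, ENNReal.ofReal (q y) ∂ν) := by
  rw [← lintegral_add_left hp.ennreal_ofReal, ← lintegral_const_mul _ (by fun_prop),
    ← lintegral_const_mul _ (by fun_prop), ← lintegral_add_left (by fun_prop)]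
  refine lintegral_mono fun y => ?_
  simp only
  rw [← ENNReal.ofReal_add (hp0 y) (hq0 y), ← ENNReal.ofReal_mul hK.le,
    ← ENNReal.ofReal_mul (inv_nonneg.2 hK.le), ← ENNReal.ofReal_add (by positivity)
    (mul_nonneg (inv_nonneg.2 hK.le) (add_nonneg (hp0 y) (hq0 y)))]
  refine ENNReal.ofReal_le_ofReal ?_
  have hs := Real.sq_sqrt (hp0 y)
  have ht := Real.sq_sqrt (hq0 y)
  set s := √(p y)
  set t := √(q y)
  rw [← hs, ← ht]
  have h1 : |s ^ 2 - t ^ 2| = |s - t| * |s + t| := by rw [← abs_mul]; ring_nf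
  rw [h1]
  have h2 : (s - t) ^ 2 = |s - t| ^ 2 := (sq_abs _).symm
  have h3 : |s + t| ^ 2 ≤ 2 * (s ^ 2 + t ^ 2) := by
    rw [sq_abs]; nlinarith [sq_nonneg (s - t)]
  rw [h2]
  -- `|s² - t²| = |s - t| |s + t|`, and Young's inequality with weight `K`
  have h4 : 0 ≤ K * (|s - t| - K⁻¹ * |s + t|) ^ 2 := by positivity
  have h5 : K * (|s - t| - K⁻¹ * |s + t|) ^ 2 =
      K * |s - t| ^ 2 - 2 * (|s - t| * |s + t|) + K⁻¹ * |s + t| ^ 2 := by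
    field_simp; ring
  have h6 : K⁻¹ * |s + t| ^ 2 ≤ K⁻¹ * (2 * (s ^ 2 + t ^ 2)) :=
    mul_le_mul_of_nonneg_left h3 (inv_nonneg.2 hK.le)
  nlinarith [mul_nonneg hK.le (sq_nonneg |s - t|)]

end L1

/-- Lower semicontinuity passes to finite sums: the inferior limit is superadditive. -/
theorem add_sum_le_of_le_liminf {ι : Type*} [Fintype ι] {a : ℕ → ℝ≥0∞} {b : ι → ℕ → ℝ≥0∞}
    {A L : ℝ≥0∞} {B : ι → ℝ≥0∞} {d : ℕ → ℝ≥0∞} (hA : A ≤ liminf a atTop)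
    (hB : ∀ i, B i ≤ liminf (b i) atTop) (h : ∀ n, a n + ∑ i, b i n ≤ L + d n)
    (hd : Tendsto d atTop (nhds 0)) : A + ∑ i, B i ≤ L := by
  have key : ∀ u : ℕ → ℝ≥0∞,
      Tendsto (fun n => ⨅ k ≥ n, u k) atTop (nhds (liminf u atTop)) := by
    intro u
    rw [liminf_eq_iSup_iInf_of_nat]
    exact tendsto_atTop_iSup fun n m hnm => biInf_mono fun k hk => hnm.trans hk
  refine (add_le_add hA (Finset.sum_le_sum fun i _ => hB i)).trans ?_
  have h1 := (key a).add (tendsto_finsetSum Finset.univ fun i _ => key (b i))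
  have h2 : Tendsto (fun n => L + d n) atTop (nhds (L + 0)) := tendsto_const_nhds.add hd
  rw [add_zero] at h2
  refine le_of_tendsto_of_tendsto' h1 h2 fun n => le_trans ?_ (h n)
  exact add_le_add (iInf₂_le n (le_refl n)) (Finset.sum_le_sum fun i _ => iInf₂_le n (le_refl n))

/-! ### The primal problem in terms of densities -/

section Densities

variable {N : ℕ} {X : Fin N → Type*} [∀ i, MeasurableSpace (X i)]

/-- A nonnegative integrable density `p` with respect to `γ^⊗`, together with nonnegative
integrable densities `r i` with respect to `μ i`. The `r i` play the role of the marginals of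
`p γ^⊗`, but no relation between `p` and `r` is imposed. -/
structure Admissible (μ γ : ∀ i, Measure (X i)) [∀ i, IsFiniteMeasure (γ i)]
    (p : (∀ i, X i) → ℝ) (r : ∀ i, X i → ℝ) : Prop where
  measurable : Measurable p
  nonneg : ∀ x, 0 ≤ p x
  integrable : Integrable p (Measure.pi γ)
  measurable_marginal : ∀ i, Measurable (r i)
  nonneg_marginal : ∀ i x, 0 ≤ r i x
  integrable_marginal : ∀ i, Integrable (r i) (μ i)

/-- The primal objective with the marginal constraint decoupled. -/
noncomputable def cost (ε : ℝ) (c : (∀ i, X i) → ℝ) (φ : Fin N → ℝ → ℝ≥0∞)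
    (μ γ : ∀ i, Measure (X i)) [∀ i, IsFiniteMeasure (γ i)] (p : (∀ i, X i) → ℝ)
    (r : ∀ i, X i → ℝ) : ℝ≥0∞ :=
  ∫⁻ x, ENNReal.ofReal (c x * p x + ε * InformationTheory.klFun (p x)) ∂(Measure.pi γ) +
    ∑ i, ∫⁻ x, φ i (r i x) ∂(μ i)

/-- The violation of the constraint that the `i`-th marginal of `p γ^⊗` be `r i μ i`, tested
against `g`. -/
noncomputable def defect (μ γ : ∀ i, Measure (X i)) [∀ i, IsFiniteMeasure (γ i)]
    (p : (∀ i, X i) → ℝ) (r : ∀ i, X i → ℝ) (i : Fin N) (g : X i → ℝ) : ℝ :=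
  ∫ x, g (x i) * p x ∂(Measure.pi γ) - ∫ x, g x * r i x ∂(μ i)

/-- The marginals of `p γ^⊗` and the measures `r i μ i` differ by at most `δ` when tested against
measurable functions bounded by `1`. -/
def DefectLE (μ γ : ∀ i, Measure (X i)) [∀ i, IsFiniteMeasure (γ i)]
    (δ : ℝ) (p : (∀ i, X i) → ℝ) (r : ∀ i, X i → ℝ) : Prop :=
  ∀ (i : Fin N) (g : X i → ℝ), Measurable g → (∀ x, |g x| ≤ 1) → |defect μ γ p r i g| ≤ δ

variable {ε : ℝ} {c : (∀ i, X i) → ℝ} {φ : Fin N → ℝ → ℝ≥0∞} {μ γ : ∀ i, Measure (X i)}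
  [∀ i, IsFiniteMeasure (γ i)] {p q : (∀ i, X i) → ℝ} {r s : ∀ i, X i → ℝ} {a b : ℝ}

theorem Admissible.combo (h : Admissible μ γ p r) (h' : Admissible μ γ q s) (ha : 0 ≤ a)
    (hb : 0 ≤ b) :
    Admissible μ γ (fun x => a * p x + b * q x) (fun i x => a * r i x + b * s i x) where
  measurable := (h.measurable.const_mul a).add (h'.measurable.const_mul b)
  nonneg x := add_nonneg (mul_nonneg ha (h.nonneg x)) (mul_nonneg hb (h'.nonneg x))
  integrable := (h.integrable.const_mul a).add (h'.integrable.const_mul b)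
  measurable_marginal i :=
    ((h.measurable_marginal i).const_mul a).add ((h'.measurable_marginal i).const_mul b)
  nonneg_marginal i x := add_nonneg (mul_nonneg ha (h.nonneg_marginal i x))
    (mul_nonneg hb (h'.nonneg_marginal i x))
  integrable_marginal i :=
    ((h.integrable_marginal i).const_mul a).add ((h'.integrable_marginal i).const_mul b)

theorem Admissible.integrable_mul (h : Admissible μ γ p r) (i : Fin N) {g : X i → ℝ}
    (hg : Measurable g) {C : ℝ} (hg1 : ∀ x, |g x| ≤ C) :
    Integrable (fun x => g (x i) * p x) (Measure.pi γ) :=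
  h.integrable.bdd_mul (hg.comp (measurable_pi_apply i)).aestronglyMeasurable
    (ae_of_all _ fun x => hg1 (x i))

theorem Admissible.integrable_marginal_mul (h : Admissible μ γ p r) (i : Fin N) {g : X i → ℝ}
    (hg : Measurable g) {C : ℝ} (hg1 : ∀ x, |g x| ≤ C) :
    Integrable (fun x => g x * r i x) (μ i) :=
  (h.integrable_marginal i).bdd_mul hg.aestronglyMeasurable (ae_of_all _ hg1)

theorem Admissible.defect_combo (h : Admissible μ γ p r) (h' : Admissible μ γ q s) (i : Fin N)
    {g : X i → ℝ} (hg : Measurable g) {C : ℝ} (hg1 : ∀ x, |g x| ≤ C) :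
    defect μ γ (fun x => a * p x + b * q x) (fun i x => a * r i x + b * s i x) i g =
      a * defect μ γ p r i g + b * defect μ γ q s i g := by
  have h1 := h.integrable_mul i hg hg1
  have h2 := h'.integrable_mul i hg hg1
  have h3 := h.integrable_marginal_mul i hg hg1
  have h4 := h'.integrable_marginal_mul i hg hg1
  have e1 : ∀ x : ∀ i, X i, g (x i) * (a * p x + b * q x) =
      a * (g (x i) * p x) + b * (g (x i) * q x) := fun x => by ring
  have e2 : ∀ x : X i, g x * (a * r i x + b * s i x) =
      a * (g x * r i x) + b * (g x * s i x) := fun x => by ring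
  simp only [defect, e1, e2]
  rw [integral_add (h1.const_mul a) (h2.const_mul b),
    integral_add (h3.const_mul a) (h4.const_mul b)]
  simp only [integral_const_mul]
  ring

theorem DefectLE.combo (h : Admissible μ γ p r) (h' : Admissible μ γ q s) {δ : ℝ}
    (hd : DefectLE μ γ δ p r) (hd' : DefectLE μ γ δ q s) (ha : 0 ≤ a) (hb : 0 ≤ b)
    (hab : a + b = 1) :
    DefectLE μ γ δ (fun x => a * p x + b * q x) (fun i x => a * r i x + b * s i x) := by
  intro i g hg hg1
  rw [h.defect_combo h' i hg hg1]
  refine (abs_add_le _ _).trans ?_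
  rw [abs_mul, abs_mul, abs_of_nonneg ha, abs_of_nonneg hb]
  have h1 := mul_le_mul_of_nonneg_left (hd i g hg hg1) ha
  have h2 := mul_le_mul_of_nonneg_left (hd' i g hg hg1) hb
  have h3 : a * δ + b * δ = δ := by rw [← add_mul, hab, one_mul]
  linarith

/-- The decoupled objective is strongly convex in `p` with respect to the Hellinger distance. -/
theorem Admissible.cost_combo (h : Admissible μ γ p r) (h' : Admissible μ γ q s)
    (hφ : ∀ i, IsEntropyFunction (φ i)) (hc : Measurable c) (hc0 : ∀ x, 0 ≤ c x) (hε : 0 < ε)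
    (ha : 0 ≤ a) (hb : 0 ≤ b) (hab : a + b = 1) :
    cost ε c φ μ γ (fun x => a * p x + b * q x) (fun i x => a * r i x + b * s i x) +
        ENNReal.ofReal (ε * (a * b)) *
          ∫⁻ x, ENNReal.ofReal ((√(p x) - √(q x)) ^ 2) ∂(Measure.pi γ) ≤
      ENNReal.ofReal a * cost ε c φ μ γ p r + ENNReal.ofReal b * cost ε c φ μ γ q s := by
  have hpm := h.measurable
  have hqm := h'.measurable
  have hk := InformationTheory.measurable_klFun
  have hab0 : 0 ≤ ε * (a * b) := by positivity
  have nn : ∀ x y, 0 ≤ y → 0 ≤ c x * y + ε * InformationTheory.klFun y := fun x y hy =>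
    add_nonneg (mul_nonneg (hc0 x) hy) (mul_nonneg hε.le (InformationTheory.klFun_nonneg hy))
  have h1 : ∫⁻ x, ENNReal.ofReal (c x * (a * p x + b * q x) +
        ε * InformationTheory.klFun (a * p x + b * q x)) ∂(Measure.pi γ) +
      ENNReal.ofReal (ε * (a * b)) *
          ∫⁻ x, ENNReal.ofReal ((√(p x) - √(q x)) ^ 2) ∂(Measure.pi γ) ≤
      ENNReal.ofReal a *
        ∫⁻ x, ENNReal.ofReal (c x * p x + ε * InformationTheory.klFun (p x)) ∂(Measure.pi γ) +
      ENNReal.ofReal b *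
        ∫⁻ x, ENNReal.ofReal (c x * q x + ε * InformationTheory.klFun (q x)) ∂(Measure.pi γ) := by
    rw [← lintegral_const_mul _ (by fun_prop), ← lintegral_const_mul _ (by fun_prop),
      ← lintegral_const_mul _ (by fun_prop), ← lintegral_add_left (by fun_prop),
      ← lintegral_add_left (by fun_prop)]
    refine lintegral_mono fun x => ?_
    simp only
    have hx := nn x _ (h.nonneg x)
    have hy := nn x _ (h'.nonneg x)
    have hz := nn x _ ((h.combo h' ha hb).nonneg x)
    rw [← ENNReal.ofReal_mul hab0, ← ENNReal.ofReal_mul ha, ← ENNReal.ofReal_mul hb,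
      ← ENNReal.ofReal_add hz (by positivity),
      ← ENNReal.ofReal_add (mul_nonneg ha hx) (mul_nonneg hb hy)]
    refine ENNReal.ofReal_le_ofReal ?_
    have := mul_le_mul_of_nonneg_left
      (klFun_strongly_convex (h.nonneg x) (h'.nonneg x) ha hb hab) hε.le
    nlinarith
  have h2 : ∀ i, ∫⁻ x, φ i (a * r i x + b * s i x) ∂(μ i) ≤
      ENNReal.ofReal a * ∫⁻ x, φ i (r i x) ∂(μ i) +
        ENNReal.ofReal b * ∫⁻ x, φ i (s i x) ∂(μ i) := by
    intro i
    have hm : Measurable (φ i) := (hφ i).lsc.measurable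
    have m1 : Measurable fun x => φ i (r i x) := hm.comp (h.measurable_marginal i)
    have m2 : Measurable fun x => φ i (s i x) := hm.comp (h'.measurable_marginal i)
    rw [← lintegral_const_mul _ m1, ← lintegral_const_mul _ m2,
      ← lintegral_add_left (m1.const_mul _)]
    exact lintegral_mono fun x => (hφ i).convex _ _ a b ha hb hab
  simp only [cost]
  calc _ = (∫⁻ x, ENNReal.ofReal (c x * (a * p x + b * q x) +
        ε * InformationTheory.klFun (a * p x + b * q x)) ∂(Measure.pi γ) +
      ENNReal.ofReal (ε * (a * b)) *
          ∫⁻ x, ENNReal.ofReal ((√(p x) - √(q x)) ^ 2) ∂(Measure.pi γ)) +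
        ∑ i, ∫⁻ x, φ i (a * r i x + b * s i x) ∂(μ i) := by ring
    _ ≤ _ := add_le_add h1 (Finset.sum_le_sum fun i _ => h2 i)
    _ = _ := by
      rw [Finset.sum_add_distrib, ← Finset.mul_sum, ← Finset.mul_sum]
      ring

end Densities

/-! ### Lower semicontinuity of the primal value -/

section Closedness

variable {N : ℕ} {X : Fin N → Type*} [∀ i, MeasurableSpace (X i)]
  {ε : ℝ} {c : (∀ i, X i) → ℝ} {φ : Fin N → ℝ → ℝ≥0∞} {μ γ : ∀ i, Measure (X i)}
  [∀ i, IsFiniteMeasure (γ i)]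

/-- The infimum of the decoupled objective over pairs that violate the marginal constraints by at
most `δ`. -/
noncomputable def relaxedValue (ε : ℝ) (c : (∀ i, X i) → ℝ) (φ : Fin N → ℝ → ℝ≥0∞)
    (μ γ : ∀ i, Measure (X i)) [∀ i, IsFiniteMeasure (γ i)] (δ : ℝ) : ℝ≥0∞ :=
  sInf {J | ∃ p r, Admissible μ γ p r ∧ DefectLE μ γ δ p r ∧ cost ε c φ μ γ p r = J}

/-- A bound on the objective bounds the mass of the density. -/
theorem Admissible.lintegral_density_le {p : (∀ i, X i) → ℝ} {r : ∀ i, X i → ℝ}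
    (h : Admissible μ γ p r) (hc0 : ∀ x, 0 ≤ c x) (hε : 0 < ε) :
    ∫⁻ x, ENNReal.ofReal (p x) ∂(Measure.pi γ) ≤
      ENNReal.ofReal (2 / ε) * cost ε c φ μ γ p r + 2 * Measure.pi γ univ := by
  have h1 : ∫⁻ x, ENNReal.ofReal (p x) ∂(Measure.pi γ) ≤ ∫⁻ x, (ENNReal.ofReal (2 / ε) *
      ENNReal.ofReal (c x * p x + ε * InformationTheory.klFun (p x)) + 2) ∂(Measure.pi γ) := by
    refine lintegral_mono fun x => ?_
    have hk := InformationTheory.klFun_nonneg (h.nonneg x)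
    have hcp := mul_nonneg (hc0 x) (h.nonneg x)
    rw [← ENNReal.ofReal_mul (by positivity), ← ENNReal.ofReal_ofNat,
      ← ENNReal.ofReal_add (by positivity) (by norm_num)]
    refine ENNReal.ofReal_le_ofReal ((le_two_mul_klFun_add_two (h.nonneg x)).trans ?_)
    have h2 : 2 / ε * (ε * InformationTheory.klFun (p x)) = 2 * InformationTheory.klFun (p x) := by
      field_simp
    have h3 : 0 ≤ 2 / ε * (c x * p x) := by positivity
    rw [mul_add]
    linarith
  refine h1.trans ?_
  rw [lintegral_add_right _ measurable_const, lintegral_const,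
    lintegral_const_mul' _ _ ENNReal.ofReal_ne_top]
  gcongr
  exact le_self_add

/-- For almost feasible pairs, the densities `r i` depend on `p` in a Lipschitz way, up to the
constraint violations. -/
theorem Admissible.lintegral_marginal_abs_sub_le {p q : (∀ i, X i) → ℝ} {r s : ∀ i, X i → ℝ}
    (h : Admissible μ γ p r) (h' : Admissible μ γ q s) {δ δ' : ℝ}
    (hd : DefectLE μ γ δ p r) (hd' : DefectLE μ γ δ' q s) (i : Fin N) :
    ∫⁻ x, ENNReal.ofReal |r i x - s i x| ∂(μ i) ≤
      ∫⁻ x, ENNReal.ofReal |p x - q x| ∂(Measure.pi γ) + ENNReal.ofReal (δ + δ') := by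
  classical
  -- test the constraint against the sign of `r i - s i`
  let g : X i → ℝ := fun x => if s i x ≤ r i x then 1 else -1
  have hg : Measurable g :=
    Measurable.ite (measurableSet_le (h'.measurable_marginal i) (h.measurable_marginal i))
      measurable_const measurable_const
  have hg1 : ∀ x, |g x| ≤ 1 := fun x => by
    simp only [g]; split_ifs <;> simp
  have hgabs : ∀ x, |r i x - s i x| = g x * r i x - g x * s i x := fun x => by
    simp only [g]
    split_ifs with h0
    · rw [abs_of_nonneg (by linarith)]; ring
    · rw [abs_of_neg (by linarith)]; ring
  have i1 := h.integrable_mul i hg hg1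
  have i2 := h'.integrable_mul i hg hg1
  have i3 := h.integrable_marginal_mul i hg hg1
  have i4 := h'.integrable_marginal_mul i hg hg1
  have hpq : Integrable (fun x => |p x - q x|) (Measure.pi γ) :=
    (h.integrable.sub h'.integrable).abs
  have hrs : Integrable (fun x => |r i x - s i x|) (μ i) :=
    ((h.integrable_marginal i).sub (h'.integrable_marginal i)).abs
  have e1 := hd i g hg hg1
  have e2 := hd' i g hg hg1
  have e3 : ∫ x, g (x i) * p x ∂(Measure.pi γ) - ∫ x, g (x i) * q x ∂(Measure.pi γ) ≤
      ∫ x, |p x - q x| ∂(Measure.pi γ) := by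
    rw [← integral_sub i1 i2]
    refine integral_mono (i1.sub i2) hpq fun x => ?_
    simp only
    rw [← mul_sub]
    refine (le_abs_self _).trans ?_
    rw [abs_mul]
    exact mul_le_of_le_one_left (abs_nonneg _) (hg1 _)
  have e4 : ∫ x, |r i x - s i x| ∂(μ i) =
      ∫ x, g x * r i x ∂(μ i) - ∫ x, g x * s i x ∂(μ i) := by
    rw [← integral_sub i3 i4]
    exact integral_congr_ae (ae_of_all _ hgabs)
  have hδ : 0 ≤ δ + δ' := add_nonneg ((abs_nonneg _).trans e1) ((abs_nonneg _).trans e2)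
  rw [← ofReal_integral_eq_lintegral_ofReal hrs (ae_of_all _ fun x => abs_nonneg _),
    ← ofReal_integral_eq_lintegral_ofReal hpq (ae_of_all _ fun x => abs_nonneg _),
    ← ENNReal.ofReal_add (integral_nonneg fun x => abs_nonneg _) hδ]
  refine ENNReal.ofReal_le_ofReal ?_
  simp only [defect] at e1 e2
  rw [e4]
  linarith [(abs_le.1 e1).1, (abs_le.1 e1).2, (abs_le.1 e2).1, (abs_le.1 e2).2]

/-- Near-minimizers of the relaxed problems with vanishing relaxation form a Cauchy sequence: the
midpoint of two of them is a competitor, so strong convexity forces their Hellinger distance to be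
small. -/
theorem exists_cauchy_minimizing (hφ : ∀ i, IsEntropyFunction (φ i)) (hc : Measurable c)
    (hc0 : ∀ x, 0 ≤ c x) (hε : 0 < ε) {α : ℝ≥0∞} (hα : α ≠ ∞)
    (h : ∀ δ > 0, ∃ p r, Admissible μ γ p r ∧ DefectLE μ γ δ p r ∧ cost ε c φ μ γ p r ≤ α) :
    ∃ (p : ℕ → (∀ i, X i) → ℝ) (r : ℕ → ∀ i, X i → ℝ),
      (∀ n, Admissible μ γ (p n) (r n)) ∧ (∀ n : ℕ, DefectLE μ γ (1 / ((n : ℝ) + 1)) (p n) (r n)) ∧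
      (∀ n : ℕ, cost ε c φ μ γ (p n) (r n) ≤ α + ENNReal.ofReal (1 / ((n : ℝ) + 1))) ∧
      ∀ η : ℝ≥0∞, 0 < η → ∃ K, ∀ n m, K ≤ n → K ≤ m →
        ∫⁻ x, ENNReal.ofReal |p n x - p m x| ∂(Measure.pi γ) ≤ η := by
  set v : ℕ → ℝ≥0∞ := fun n => relaxedValue ε c φ μ γ (1 / ((n : ℝ) + 1)) with hv
  have hpos : ∀ n : ℕ, (0 : ℝ) < 1 / ((n : ℝ) + 1) := fun n => Nat.one_div_pos_of_nat
  have hanti : ∀ {n m : ℕ}, n ≤ m → (1 : ℝ) / ((m : ℝ) + 1) ≤ 1 / ((n : ℝ) + 1) :=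
    fun h => Nat.one_div_le_one_div h
  have hvα : ∀ n, v n ≤ α := fun n => by
    obtain ⟨p, r, h1, h2, h3⟩ := h _ (hpos n)
    exact le_trans (sInf_le ⟨p, r, h1, h2, rfl⟩) h3
  have hvmono : Monotone v := fun n m hnm => by
    refine sInf_le_sInf ?_
    rintro _ ⟨p, r, h1, h2, rfl⟩
    exact ⟨p, r, h1, fun i g hg hg1 => (h2 i g hg hg1).trans (hanti hnm), rfl⟩
  have hsel : ∀ n : ℕ, ∃ p r, Admissible μ γ p r ∧ DefectLE μ γ (1 / ((n : ℝ) + 1)) p r ∧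
      cost ε c φ μ γ p r < v n + ENNReal.ofReal (1 / ((n : ℝ) + 1)) := by
    intro n
    have hlt : v n < v n + ENNReal.ofReal (1 / ((n : ℝ) + 1)) :=
      ENNReal.lt_add_right (ne_top_of_le_ne_top hα (hvα n)) (ENNReal.ofReal_pos.2 (hpos n)).ne'
    obtain ⟨_, ⟨p, r, h1, h2, rfl⟩, h3⟩ := sInf_lt_iff.1 hlt
    exact ⟨p, r, h1, h2, h3⟩
  choose p r hadm hdef hcost using hsel
  have hcα : ∀ n : ℕ, cost ε c φ μ γ (p n) (r n) ≤ α + ENNReal.ofReal (1 / ((n : ℝ) + 1)) :=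
    fun n => (hcost n).le.trans (add_le_add (hvα n) le_rfl)
  refine ⟨p, r, hadm, hdef, hcα, fun η hη => ?_⟩
  set H : ℕ → ℕ → ℝ≥0∞ := fun n m =>
    ∫⁻ x, ENNReal.ofReal ((√(p n x) - √(p m x)) ^ 2) ∂(Measure.pi γ) with hH
  set V := ⨆ n, v n with hV
  have hVα : V ≤ α := iSup_le hvα
  have hVtop : V ≠ ∞ := ne_top_of_le_ne_top hα hVα
  have hmid : ∀ k n m, k ≤ n → k ≤ m → v k + ENNReal.ofReal (ε / 4) * H n m ≤
      V + ENNReal.ofReal (1 / ((k : ℝ) + 1)) := by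
    intro k n m hkn hkm
    have h1 := (hadm n).cost_combo (hadm m) hφ hc hc0 hε (a := 1 / 2) (b := 1 / 2)
      (by norm_num) (by norm_num) (by norm_num)
    have h2 : v k ≤ cost ε c φ μ γ (fun x => 1 / 2 * p n x + 1 / 2 * p m x)
        (fun i x => 1 / 2 * r n i x + 1 / 2 * r m i x) :=
      sInf_le ⟨_, _, (hadm n).combo (hadm m) (by norm_num) (by norm_num),
        DefectLE.combo (hadm n) (hadm m)
          (fun i g hg hg1 => (hdef n i g hg hg1).trans (hanti hkn))
          (fun i g hg hg1 => (hdef m i g hg hg1).trans (hanti hkm))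
          (by norm_num) (by norm_num) (by norm_num), rfl⟩
    have h3 : ∀ j, k ≤ j → cost ε c φ μ γ (p j) (r j) ≤ V + ENNReal.ofReal (1 / ((k : ℝ) + 1)) :=
      fun j hj => (hcost j).le.trans
        (add_le_add (le_iSup v j) (ENNReal.ofReal_le_ofReal (hanti hj)))
    rw [show ε * (1 / 2 * (1 / 2)) = ε / 4 by ring] at h1
    refine (add_le_add h2 le_rfl).trans (h1.trans ?_)
    refine (add_le_add (mul_le_mul_right (h3 n hkn) _) (mul_le_mul_right (h3 m hkm) _)).trans ?_
    rw [← add_mul, ← ENNReal.ofReal_add (by norm_num) (by norm_num)]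
    norm_num
  -- a common bound for the masses of the near-minimizers
  set C : ℝ≥0∞ := ENNReal.ofReal (2 / ε) * (α + 1) + 2 * Measure.pi γ univ with hC
  have hCtop : C ≠ ∞ := by
    refine ENNReal.add_ne_top.2 ⟨ENNReal.mul_ne_top ENNReal.ofReal_ne_top ?_,
      ENNReal.mul_ne_top (by simp) (measure_ne_top _ _)⟩
    exact ENNReal.add_ne_top.2 ⟨hα, ENNReal.one_ne_top⟩
  have hmass : ∀ n, ∫⁻ x, ENNReal.ofReal (p n x) ∂(Measure.pi γ) ≤ C := by
    intro n
    refine ((hadm n).lintegral_density_le (φ := φ) hc0 hε).trans ?_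
    refine add_le_add (mul_le_mul_right ((hcα n).trans (add_le_add le_rfl ?_)) _) le_rfl
    refine ENNReal.ofReal_le_one.2 ?_
    have := hanti (Nat.zero_le n)
    simpa using this
  obtain ⟨L, hL0, hL⟩ : ∃ L : ℝ, 0 < L ∧ ENNReal.ofReal L⁻¹ * (C + C) ≤ η / 2 := by
    have hη2 : 0 < η / 2 := ENNReal.half_pos hη.ne'
    have ht : Tendsto (fun n : ℕ => ENNReal.ofReal (1 / ((n : ℝ) + 1)) * (C + C)) atTop
        (nhds (ENNReal.ofReal 0 * (C + C))) :=
      ENNReal.Tendsto.mul_const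
        (ENNReal.tendsto_ofReal tendsto_one_div_add_atTop_nhds_zero_nat)
        (Or.inr (ENNReal.add_ne_top.2 ⟨hCtop, hCtop⟩))
    rw [ENNReal.ofReal_zero, zero_mul] at ht
    obtain ⟨n, hn⟩ := (ht.eventually (gt_mem_nhds hη2)).exists
    refine ⟨(n : ℝ) + 1, by positivity, ?_⟩
    rw [← one_div]
    exact hn.le
  obtain ⟨k, hk⟩ : ∃ k : ℕ, ENNReal.ofReal (4 * L / ε) *
      (V + ENNReal.ofReal (1 / ((k : ℝ) + 1)) - v k) ≤ η / 2 := by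
    have hη2 : 0 < η / 2 := ENNReal.half_pos hη.ne'
    have hvt : Tendsto v atTop (nhds V) := tendsto_atTop_iSup hvmono
    have h1 : Tendsto (fun k : ℕ => V + ENNReal.ofReal (1 / ((k : ℝ) + 1)) - v k) atTop
        (nhds (V + ENNReal.ofReal 0 - V)) :=
      ENNReal.Tendsto.sub (tendsto_const_nhds.add
        (ENNReal.tendsto_ofReal tendsto_one_div_add_atTop_nhds_zero_nat)) hvt (Or.inr hVtop)
    have ht := ENNReal.Tendsto.const_mul (a := ENNReal.ofReal (4 * L / ε)) h1
      (Or.inr ENNReal.ofReal_ne_top)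
    rw [ENNReal.ofReal_zero, add_zero, tsub_self, mul_zero] at ht
    obtain ⟨n, hn⟩ := (ht.eventually (gt_mem_nhds hη2)).exists
    exact ⟨n, hn.le⟩
  refine ⟨k, fun n m hn hm => ?_⟩
  refine (lintegral_abs_sub_le (hadm n).measurable (hadm m).measurable (hadm n).nonneg
    (hadm m).nonneg hL0).trans ?_
  rw [← ENNReal.add_halves η]
  refine add_le_add ?_ ((mul_le_mul_right (add_le_add (hmass n) (hmass m)) _).trans hL)
  have h1 : ENNReal.ofReal (ε / 4) * H n m ≤ V + ENNReal.ofReal (1 / ((k : ℝ) + 1)) - v k :=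
    ENNReal.le_sub_of_add_le_left (ne_top_of_le_ne_top hα (hvα k)) (hmid k n m hn hm)
  calc ENNReal.ofReal L * H n m =
        ENNReal.ofReal (4 * L / ε) * (ENNReal.ofReal (ε / 4) * H n m) := by
        rw [← mul_assoc, ← ENNReal.ofReal_mul (by positivity)]
        congr 2
        field_simp
    _ ≤ _ := (mul_le_mul_right h1 _).trans hk

/-- The infimum over exactly feasible pairs is not larger than the limit of the infima of the
relaxed problems. -/
theorem exists_feasible_of_relaxed (hφ : ∀ i, IsEntropyFunction (φ i)) (hc : Measurable c)
    (hc0 : ∀ x, 0 ≤ c x) (hε : 0 < ε) {α : ℝ≥0∞} (hα : α ≠ ∞)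
    (h : ∀ δ > 0, ∃ p r, Admissible μ γ p r ∧ DefectLE μ γ δ p r ∧ cost ε c φ μ γ p r ≤ α) :
    ∃ p r, Admissible μ γ p r ∧ DefectLE μ γ 0 p r ∧ cost ε c φ μ γ p r ≤ α := by
  obtain ⟨p, r, hadm, hdef, hcost, hcau⟩ := exists_cauchy_minimizing hφ hc hc0 hε hα h
  have h2pos : ∀ k : ℕ, (0 : ℝ≥0∞) < 2⁻¹ ^ k := fun k => ENNReal.pow_pos (by simp) k
  -- ranks from which on all sequences are `2⁻ᵏ`-Cauchy
  have hfast : ∀ k : ℕ, ∃ K, ∀ n m, K ≤ n → K ≤ m →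
      ∫⁻ x, ENNReal.ofReal |p n x - p m x| ∂(Measure.pi γ) < 2⁻¹ ^ k ∧
      ∀ i, ∫⁻ x, ENNReal.ofReal |r n i x - r m i x| ∂(μ i) < 2⁻¹ ^ k := by
    intro k
    have h4 : (0 : ℝ≥0∞) < 2⁻¹ ^ k / 2 / 2 :=
      ENNReal.half_pos (ENNReal.half_pos (h2pos k).ne').ne'
    have hktop : (2⁻¹ ^ k : ℝ≥0∞) ≠ ∞ := ENNReal.pow_ne_top (by simp)
    have hlt : (2⁻¹ ^ k / 2 : ℝ≥0∞) < 2⁻¹ ^ k := ENNReal.half_lt_self (h2pos k).ne' hktop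
    obtain ⟨K, hK⟩ := hcau _ h4
    have ht : Tendsto (fun n : ℕ => ENNReal.ofReal (1 / ((n : ℝ) + 1) + 1 / ((n : ℝ) + 1))) atTop
        (nhds 0) := by
      have := ENNReal.tendsto_ofReal ((tendsto_one_div_add_atTop_nhds_zero_nat (𝕜 := ℝ)).add
        tendsto_one_div_add_atTop_nhds_zero_nat)
      simpa using this
    obtain ⟨K', hK'⟩ := (ht.eventually (gt_mem_nhds h4)).exists
    refine ⟨max K K', fun n m hn hm => ?_⟩
    have h5 := hK n m ((le_max_left _ _).trans hn) ((le_max_left _ _).trans hm)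
    refine ⟨(h5.trans ENNReal.half_le_self).trans_lt hlt, fun i => ?_⟩
    refine lt_of_le_of_lt ?_ hlt
    refine ((hadm n).lintegral_marginal_abs_sub_le (hadm m) (hdef n) (hdef m) i).trans ?_
    rw [← ENNReal.add_halves (2⁻¹ ^ k / 2)]
    refine add_le_add h5 (le_trans (ENNReal.ofReal_le_ofReal (add_le_add ?_ ?_)) hK'.le)
    · exact Nat.one_div_le_one_div ((le_max_right _ _).trans hn)
    · exact Nat.one_div_le_one_div ((le_max_right _ _).trans hm)
  obtain ⟨ψ, hψ, hψK⟩ := extraction_forall_of_eventually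
    (P := fun k K => ∀ n m, K ≤ n → K ≤ m →
      ∫⁻ x, ENNReal.ofReal |p n x - p m x| ∂(Measure.pi γ) < 2⁻¹ ^ k ∧
      ∀ i, ∫⁻ x, ENNReal.ofReal |r n i x - r m i x| ∂(μ i) < 2⁻¹ ^ k) (fun k => by
      obtain ⟨K, hK⟩ := hfast k
      exact eventually_atTop.2 ⟨K, fun K' hK' n m hn hm => hK n m (hK'.trans hn) (hK'.trans hm)⟩)
  obtain ⟨P, hPm, hP0, hPi, hPae, hPlim⟩ := exists_limit_of_fast_cauchy
    (f := fun n => p (ψ n)) (ν := Measure.pi γ)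
    (fun n => (hadm _).measurable) (fun n => (hadm _).nonneg) (fun n => (hadm _).integrable)
    (fun k n m hn hm => by
      rw [eLpNorm_one_eq_lintegral_enorm]
      simp only [Real.enorm_eq_ofReal_abs]
      exact (hψK k _ _ (hψ.monotone hn) (hψ.monotone hm)).1)
  have hr := fun i => exists_limit_of_fast_cauchy (f := fun n => r (ψ n) i) (ν := μ i)
    (fun n => (hadm _).measurable_marginal i) (fun n => (hadm _).nonneg_marginal i)
    (fun n => (hadm _).integrable_marginal i)
    (fun k n m hn hm => by
      rw [eLpNorm_one_eq_lintegral_enorm]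
      simp only [Real.enorm_eq_ofReal_abs]
      exact (hψK k _ _ (hψ.monotone hn) (hψ.monotone hm)).2 i)
  choose R hRm hR0 hRi hRae hRlim using hr
  have hdt : Tendsto (fun n : ℕ => (1 : ℝ) / ((ψ n : ℝ) + 1)) atTop (nhds 0) :=
    tendsto_one_div_add_atTop_nhds_zero_nat.comp hψ.tendsto_atTop
  refine ⟨P, R, ⟨hPm, hP0, hPi, hRm, hR0, hRi⟩, fun i g hg hg1 => ?_, ?_⟩
  · have hmap := hPlim (fun x => g (x i)) (hg.comp (measurable_pi_apply i)) fun x => hg1 _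
    refine le_of_tendsto_of_tendsto' (hmap.sub (hRlim i g hg hg1)).abs hdt fun n => ?_
    exact hdef (ψ n) i g hg hg1
  · refine add_sum_le_of_le_liminf
      (a := fun n => ∫⁻ x, ENNReal.ofReal (c x * p (ψ n) x +
        ε * InformationTheory.klFun (p (ψ n) x)) ∂(Measure.pi γ))
      (b := fun i n => ∫⁻ x, φ i (r (ψ n) i x) ∂(μ i))
      (d := fun n => ENNReal.ofReal (1 / ((ψ n : ℝ) + 1))) ?_ (fun i => ?_) (fun n => hcost _) ?_
    · have hk := InformationTheory.measurable_klFun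
      refine le_trans (lintegral_mono_ae ?_) (lintegral_liminf_le fun n => ?_)
      · filter_upwards [hPae] with x hx
        refine le_of_eq (Tendsto.liminf_eq ?_).symm
        refine ENNReal.tendsto_ofReal ((hx.const_mul _).add (Tendsto.const_mul _ ?_))
        exact (InformationTheory.continuous_klFun.tendsto _).comp hx
      · have := (hadm (ψ n)).measurable
        fun_prop
    · have hm : Measurable (φ i) := (hφ i).lsc.measurable
      refine le_trans (lintegral_mono_ae ?_)
        (lintegral_liminf_le fun n => hm.comp ((hadm (ψ n)).measurable_marginal i))
      filter_upwards [hRae i] with x hx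
      refine le_of_forall_lt fun y hy => ?_
      obtain ⟨z, hyz, hz⟩ := exists_between hy
      exact hyz.trans_le (le_liminf_of_le (by isBoundedDefault)
        ((hx.eventually ((hφ i).lsc (R i x) z hz)).mono fun n hn => hn.le))
    · simpa using ENNReal.tendsto_ofReal hdt

end Closedness

/-! ### Feasible densities and the primal objective -/

section Primal

theorem divergence_withDensity {Y : Type*} [MeasurableSpace Y] (φ : ℝ → ℝ≥0∞) (ν : Measure Y)
    [IsFiniteMeasure ν] {r : Y → ℝ} (hr : Measurable r) (hr0 : ∀ y, 0 ≤ r y) :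
    divergence φ (ν.withDensity fun y => ENNReal.ofReal (r y)) ν = ∫⁻ y, φ (r y) ∂ν := by
  rw [divergence, Measure.singularPart_withDensity]
  simp only [Measure.coe_zero, Pi.zero_apply, mul_zero, add_zero]
  refine lintegral_congr_ae ?_
  filter_upwards [Measure.rnDeriv_withDensity ν hr.ennreal_ofReal] with y hy
  rw [hy, ENNReal.toReal_ofReal (hr0 y)]

variable {N : ℕ} {X : Fin N → Type*} [∀ i, TopologicalSpace (X i)] [∀ i, CompactSpace (X i)]
  [∀ i, PolishSpace (X i)] [∀ i, MeasurableSpace (X i)] [∀ i, BorelSpace (X i)]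
  {ε : ℝ} {c : C(∀ i, X i, ℝ)} {φ : Fin N → ℝ → ℝ≥0∞} {μ γ : ∀ i, Measure (X i)}
  [∀ i, IsFiniteMeasure (μ i)] [∀ i, IsFiniteMeasure (γ i)]

/-- If the marginals of `p γ^⊗` are exactly `r i μ i`, then the decoupled objective is the primal
objective at `p γ^⊗`. -/
theorem Admissible.exists_primal_eq {p : (∀ i, X i) → ℝ} {r : ∀ i, X i → ℝ}
    (h : Admissible μ γ p r) (hd : DefectLE μ γ 0 p r) (hc0 : ∀ x, 0 ≤ c x) (hε : 0 < ε) :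
    ∃ π : FiniteMeasure (∀ i, X i), primal ε c φ μ γ π = cost ε c φ μ γ p r := by
  classical
  let P : Measure (∀ i, X i) := (Measure.pi γ).withDensity fun x => ENNReal.ofReal (p x)
  have hPfin : IsFiniteMeasure P := isFiniteMeasure_withDensity_ofReal h.integrable.2
  have hpm := h.measurable
  have hcm : Measurable c := c.continuous.measurable
  have hk := InformationTheory.measurable_klFun
  refine ⟨⟨P, hPfin⟩, ?_⟩
  have hmarg : ∀ i, P.map (fun x => x i) = (μ i).withDensity fun y => ENNReal.ofReal (r i y) := by
    intro i
    ext s hs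
    have hg : Measurable (s.indicator (1 : X i → ℝ)) := measurable_one.indicator hs
    have hg1 : ∀ x, |s.indicator (1 : X i → ℝ) x| ≤ 1 := fun x => by
      by_cases hx : x ∈ s <;> simp [hx]
    have h0 := abs_nonpos_iff.1 (hd i _ hg hg1)
    rw [Measure.map_apply (measurable_pi_apply i) hs,
      withDensity_apply _ (measurable_pi_apply i hs), withDensity_apply _ hs,
      ← ofReal_integral_eq_lintegral_ofReal h.integrable.integrableOn (ae_of_all _ h.nonneg),
      ← ofReal_integral_eq_lintegral_ofReal (h.integrable_marginal i).integrableOn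
        (ae_of_all _ (h.nonneg_marginal i)), ← integral_indicator (measurable_pi_apply i hs),
      ← integral_indicator hs]
    congr 1
    rw [defect, sub_eq_zero] at h0
    refine (integral_congr_ae (ae_of_all _ fun x => ?_)).trans
      (h0.trans (integral_congr_ae (ae_of_all _ fun x => ?_)))
    · by_cases hx : x i ∈ s <;> simp [indicator, hx]
    · by_cases hx : x ∈ s <;> simp [hx]
  have hkl : InformationTheory.klDiv P (Measure.pi γ) =
      ∫⁻ x, ENNReal.ofReal (InformationTheory.klFun (p x)) ∂(Measure.pi γ) := by
    rw [InformationTheory.klDiv_eq_lintegral_klFun_of_ac (withDensity_absolutelyContinuous _ _)]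
    refine lintegral_congr_ae ?_
    filter_upwards [Measure.rnDeriv_withDensity (Measure.pi γ) hpm.ennreal_ofReal] with x hx
    rw [hx, ENNReal.toReal_ofReal (h.nonneg x)]
  have hcp : Integrable (fun x => c x * p x) (Measure.pi γ) :=
    h.integrable.bdd_mul hcm.aestronglyMeasurable (ae_of_all _ fun x => c.norm_coe_le_norm x)
  have hcint : ((∫ x, c x ∂P : ℝ) : EReal) =
      ((∫⁻ x, ENNReal.ofReal (c x * p x) ∂(Measure.pi γ) : ℝ≥0∞) : EReal) := by
    have h0 : ∀ x, 0 ≤ c x * p x := fun x => mul_nonneg (hc0 x) (h.nonneg x)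
    have h1 : ∫ x, c x ∂P = ∫ x, c x * p x ∂(Measure.pi γ) := by
      rw [integral_withDensity_eq_integral_toReal_smul hpm.ennreal_ofReal
        (ae_of_all _ fun x => ENNReal.ofReal_lt_top)]
      refine integral_congr_ae (ae_of_all _ fun x => ?_)
      simp only [smul_eq_mul]
      rw [ENNReal.toReal_ofReal (h.nonneg x), mul_comm]
    rw [h1, ← ofReal_integral_eq_lintegral_ofReal hcp (ae_of_all _ h0), EReal.coe_ennreal_ofReal,
      max_eq_left (integral_nonneg h0)]
  simp only [primal, FiniteMeasure.toMeasure_mk, cost]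
  rw [hcint, ← EReal.coe_ennreal_add]
  congr 1
  rw [hkl, ← add_assoc]
  congr 1
  · rw [← lintegral_const_mul _ (by fun_prop), ← lintegral_add_left (by fun_prop)]
    refine lintegral_congr fun x => ?_
    rw [← ENNReal.ofReal_mul hε.le, ← ENNReal.ofReal_add (mul_nonneg (hc0 x) (h.nonneg x))
      (mul_nonneg hε.le (InformationTheory.klFun_nonneg (h.nonneg x)))]
  · refine Finset.sum_congr rfl fun i _ => ?_
    rw [hmarg, divergence_withDensity _ _ (h.measurable_marginal i) (h.nonneg_marginal i)]

end Primal

/-! ### The dual functional -/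

section Dual

theorem coe_sum_ereal {ι : Type*} (s : Finset ι) (f : ι → ℝ) :
    ((∑ i ∈ s, f i : ℝ) : EReal) = ∑ i ∈ s, (f i : EReal) := by
  classical
  induction s using Finset.induction_on with
  | empty => simp
  | insert a s ha ih => rw [Finset.sum_insert ha, Finset.sum_insert ha, EReal.coe_add, ih]

theorem sum_ne_bot_ereal {ι : Type*} (s : Finset ι) (f : ι → EReal) (h : ∀ i ∈ s, f i ≠ ⊥) :
    ∑ i ∈ s, f i ≠ ⊥ := by
  classical
  induction s using Finset.induction_on with
  | empty => simp
  | insert a s ha ih =>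
    rw [Finset.sum_insert ha, Ne, EReal.add_eq_bot_iff, not_or]
    exact ⟨h a (Finset.mem_insert_self a s), ih fun i hi => h i (Finset.mem_insert_of_mem hi)⟩

theorem ae_abs_le_norm {Y : Type*} [MeasurableSpace Y] {ν : Measure Y} (f : Lp ℝ ∞ ν) :
    ∀ᵐ y ∂ν, |f y| ≤ ‖f‖ := by
  have h := ae_le_lpNorm_exponent_top (Lp.memLp f)
  have h2 : lpNorm f ∞ ν = ‖f‖ := by
    rw [Lp.norm_def, toReal_eLpNorm (Lp.aestronglyMeasurable f)]
  rwa [h2] at h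

theorem measurable_coe_Lp {Y : Type*} [MeasurableSpace Y] {ν : Measure Y} {p : ℝ≥0∞}
    (f : Lp ℝ p ν) : Measurable f :=
  (Lp.stronglyMeasurable f).measurable

/-- The negative part of `φ* (-f)` is integrable because `φ* (-f) ≥ -f` and `f` is bounded. -/
theorem lintegral_neg_conj_ne_top {Y : Type*} [MeasurableSpace Y] {ν : Measure Y}
    [IsFiniteMeasure ν] {φ : ℝ → ℝ≥0∞} (h1 : φ 1 = 0) {f : Y → ℝ} {C : ℝ}
    (hf : ∀ᵐ y ∂ν, |f y| ≤ C) : ∫⁻ y, (-(conj φ (-(f y)))).toENNReal ∂ν ≠ ∞ := by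
  refine ne_top_of_le_ne_top (b := ∫⁻ _, ENNReal.ofReal C ∂ν) ?_ (lintegral_mono_ae ?_)
  · rw [lintegral_const]
    exact ENNReal.mul_ne_top ENNReal.ofReal_ne_top (measure_ne_top _ _)
  · filter_upwards [hf] with y hy
    have h := EReal.neg_le_neg_iff.2 (le_conj h1 (-(f y)))
    refine (EReal.toENNReal_le_toENNReal h).trans ?_
    rw [← EReal.coe_neg, EReal.toENNReal_of_ne_top (EReal.coe_ne_top _), EReal.toReal_coe]
    exact ENNReal.ofReal_le_ofReal (by linarith [le_abs_self (f y)])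

theorem ae_abs_le_norm_pi {N : ℕ} {X : Fin N → Type*} [∀ i, MeasurableSpace (X i)]
    {γ : ∀ i, Measure (X i)} [∀ i, IsFiniteMeasure (γ i)] (f : ∀ i, Lp ℝ ∞ (γ i)) :
    ∀ᵐ x ∂(Measure.pi γ), ∀ i, |f i (x i)| ≤ ‖f i‖ :=
  ae_all_iff.2 fun i => (Measure.quasiMeasurePreserving_eval γ i).ae (ae_abs_le_norm (f i))

variable {N : ℕ} {X : Fin N → Type*} [∀ i, TopologicalSpace (X i)] [∀ i, MeasurableSpace (X i)]
  {ε : ℝ} {c : C(∀ i, X i, ℝ)} {φ : Fin N → ℝ → ℝ≥0∞} {μ γ : ∀ i, Measure (X i)}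

theorem gibbs_pos (f : ∀ i, Lp ℝ ∞ (γ i)) (x : ∀ i, X i) : 0 < gibbs ε c f x := Real.exp_pos _

theorem measurable_gibbs [∀ i, PolishSpace (X i)] [∀ i, BorelSpace (X i)]
    (f : ∀ i, Lp ℝ ∞ (γ i)) : Measurable (gibbs ε c f) := by
  have h1 : Measurable c := c.continuous.measurable
  have h2 : ∀ i, Measurable fun x : ∀ i, X i => f i (x i) := fun i =>
    (measurable_coe_Lp (f i)).comp (measurable_pi_apply i)
  unfold gibbs
  fun_prop

variable [∀ i, IsFiniteMeasure (γ i)]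

theorem integrable_gibbs [∀ i, PolishSpace (X i)] [∀ i, BorelSpace (X i)]
    (f : ∀ i, Lp ℝ ∞ (γ i)) (hc0 : ∀ x, 0 ≤ c x) (hε : 0 < ε) :
    Integrable (gibbs ε c f) (Measure.pi γ) := by
  refine Integrable.of_bound (measurable_gibbs f).aestronglyMeasurable
    (Real.exp ((∑ i, ‖f i‖) / ε)) ?_
  filter_upwards [ae_abs_le_norm_pi f] with x hx
  rw [Real.norm_eq_abs, abs_of_pos (gibbs_pos f x), gibbs]
  refine Real.exp_le_exp.2 (div_le_div_of_nonneg_right ?_ hε.le)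
  have : ∑ i, f i (x i) ≤ ∑ i, ‖f i‖ :=
    Finset.sum_le_sum fun i _ => (le_abs_self _).trans (hx i)
  linarith [hc0 x]

/-- Finiteness of the dual functional at `f`: the functions `φ i* (-f i)` are finite almost
everywhere and integrable. -/
def DualFinite (φ : Fin N → ℝ → ℝ≥0∞) (μ : ∀ i, Measure (X i)) {γ : ∀ i, Measure (X i)}
    (f : ∀ i, Lp ℝ ∞ (γ i)) : Prop :=
  ∀ i, (∀ᵐ x ∂(μ i), conj (φ i) (-(f i x)) ≠ ⊤) ∧
    Integrable (fun x => (conj (φ i) (-(f i x))).toReal) (μ i)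

/-- The real value of the dual functional where it is finite. -/
noncomputable def dualReal (ε : ℝ) (c : C(∀ i, X i, ℝ)) (φ : Fin N → ℝ → ℝ≥0∞)
    (μ γ : ∀ i, Measure (X i)) [∀ i, IsFiniteMeasure (γ i)] (f : ∀ i, Lp ℝ ∞ (γ i)) : ℝ :=
  -(∑ i, ∫ x, (conj (φ i) (-(f i x))).toReal ∂(μ i)) -
    ε * ∫ x, (gibbs ε c f x - 1) ∂(Measure.pi γ)

theorem DualFinite.dual_eq (h1 : ∀ i, φ i 1 = 0) {f : ∀ i, Lp ℝ ∞ (γ i)}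
    (h : DualFinite φ μ f) : dual ε c φ μ γ f = (dualReal ε c φ μ γ f : EReal) := by
  have h2 : ∀ i, eintegral (μ i) (fun x => conj (φ i) (-(f i x))) =
      ((∫ x, (conj (φ i) (-(f i x))).toReal ∂(μ i) : ℝ) : EReal) := fun i =>
    eintegral_eq_integral ((h i).1.mono fun x hx => ⟨hx, conj_ne_bot (h1 i) _⟩) (h i).2
  simp only [dual, h2, dualReal]
  rw [EReal.coe_sub, EReal.coe_neg, coe_sum_ereal]

variable [∀ i, IsFiniteMeasure (μ i)]

theorem dual_ne_bot_iff (h1 : ∀ i, φ i 1 = 0) (hμγ : ∀ i, μ i ≪ γ i)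
    {f : ∀ i, Lp ℝ ∞ (γ i)} : dual ε c φ μ γ f ≠ ⊥ ↔ DualFinite φ μ f := by
  classical
  refine ⟨fun h i => ?_, fun h => by rw [h.dual_eq h1]; exact EReal.coe_ne_bot _⟩
  have hneg : ∀ j, ∫⁻ x, (-(conj (φ j) (-(f j x)))).toENNReal ∂(μ j) ≠ ∞ := fun j =>
    lintegral_neg_conj_ne_top (h1 j) ((hμγ j).ae_le (ae_abs_le_norm (f j)))
  have hm : Measurable fun x => conj (φ i) (-(f i x)) :=
    (measurable_conj (h1 i)).comp (measurable_coe_Lp (f i)).neg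
  suffices hi : eintegral (μ i) (fun x => conj (φ i) (-(f i x))) ≠ ⊤ by
    have := integrable_of_eintegral_ne_top hm (hneg i) hi
    exact ⟨this.1.mono fun x hx => hx.1, this.2⟩
  intro hi
  refine h ?_
  rw [dual, ← Finset.add_sum_erase _ _ (Finset.mem_univ i), hi,
    EReal.top_add_of_ne_bot (sum_ne_bot_ereal _ _ fun j _ => eintegral_ne_bot (hneg j)),
    EReal.neg_top, EReal.bot_sub]

theorem dual_ne_top (h1 : ∀ i, φ i 1 = 0) (hμγ : ∀ i, μ i ≪ γ i)
    (f : ∀ i, Lp ℝ ∞ (γ i)) : dual ε c φ μ γ f ≠ ⊤ := by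
  by_cases h : dual ε c φ μ γ f = ⊥
  · rw [h]; exact bot_ne_top
  · rw [((dual_ne_bot_iff h1 hμγ).1 h).dual_eq h1]
    exact EReal.coe_ne_top _

end Dual

/-! ### Weak duality -/

section Weak

/-- The Fenchel–Young inequality for divergences. The singular part of `ρ` vanishes, either
because `ρ ≪ γ ≪ ν` or because it carries infinite cost. -/
theorem divergence_fenchel_young {Y : Type*} [MeasurableSpace Y] {φ : ℝ → ℝ≥0∞}
    (hφ : IsEntropyFunction φ) {ρ ν γ : Measure Y} [IsFiniteMeasure ρ] [IsFiniteMeasure ν]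
    (hργ : ρ ≪ γ) (hac : γ ≪ ν ∨ recession φ = ∞) (hD : divergence φ ρ ν ≠ ∞)
    {f : Y → ℝ} (hf : Measurable f) {C : ℝ} (hfC : ∀ᵐ y ∂γ, |f y| ≤ C)
    (hfin : ∀ᵐ y ∂ν, conj φ (-(f y)) ≠ ⊤)
    (hint : Integrable (fun y => (conj φ (-(f y))).toReal) ν) :
    0 ≤ (divergence φ ρ ν).toReal + ∫ y, (conj φ (-(f y))).toReal ∂ν + ∫ y, f y ∂ρ := by
  have hρν : ρ ≪ ν := by
    rcases hac with h | h
    · exact hργ.trans h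
    · rw [← Measure.singularPart_eq_zero]
      by_contra h0
      refine hD ?_
      rw [divergence, h, ENNReal.top_mul, add_top]
      rwa [Ne, Measure.measure_univ_eq_zero]
  have hDeq : divergence φ ρ ν = ∫⁻ y, φ (ρ.rnDeriv ν y).toReal ∂ν := by
    rw [divergence, (Measure.singularPart_eq_zero _ _).2 hρν]
    simp
  have hσm : Measurable fun y => (ρ.rnDeriv ν y).toReal :=
    (Measure.measurable_rnDeriv _ _).ennreal_toReal
  have hφσ : Measurable fun y => φ (ρ.rnDeriv ν y).toReal := hφ.lsc.measurable.comp hσm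
  rw [hDeq] at hD ⊢
  have hae : ∀ᵐ y ∂ν, φ (ρ.rnDeriv ν y).toReal < ∞ := ae_lt_top hφσ hD
  have hφint := integrable_toReal_of_lintegral_ne_top hφσ.aemeasurable hD
  rw [← integral_toReal hφσ.aemeasurable hae]
  have hfint : Integrable f ρ :=
    Integrable.of_bound hf.aestronglyMeasurable C (hργ.ae_le hfC)
  have hfint' : Integrable (fun y => (ρ.rnDeriv ν y).toReal * f y) ν :=
    (integrable_rnDeriv_smul_iff hρν).2 hfint
  have hsum : Integrable (fun y => (φ (ρ.rnDeriv ν y).toReal).toReal +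
    (conj φ (-(f y))).toReal) ν := hφint.add hint
  rw [← integral_toReal_rnDeriv_mul hρν, ← integral_add hφint hint,
    ← integral_add hsum hfint']
  refine integral_nonneg_of_ae ?_
  filter_upwards [hae, hfin] with y h1 h2
  have := mul_le_toReal_add_conj hφ.one h1.ne h2
  simp only [Pi.zero_apply]
  linarith

variable {N : ℕ} {X : Fin N → Type*} [∀ i, TopologicalSpace (X i)]
  [∀ i, PolishSpace (X i)] [∀ i, MeasurableSpace (X i)] [∀ i, BorelSpace (X i)]
  {ε : ℝ} {c : C(∀ i, X i, ℝ)} {φ : Fin N → ℝ → ℝ≥0∞} {μ γ : ∀ i, Measure (X i)}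
  [∀ i, IsFiniteMeasure (γ i)]

/-- The squared Hellinger distance between `π` and the Gibbs measure of `f`. Only the absolutely
continuous part of `π` with respect to `γ^⊗` enters. -/
noncomputable def hellingerGibbs (ε : ℝ) (c : C(∀ i, X i, ℝ)) (γ : ∀ i, Measure (X i))
    [∀ i, IsFiniteMeasure (γ i)] (π : FiniteMeasure (∀ i, X i)) (f : ∀ i, Lp ℝ ∞ (γ i)) : ℝ :=
  ∫ x, (√(((π : Measure (∀ i, X i)).rnDeriv (Measure.pi γ) x).toReal) - √(gibbs ε c f x)) ^ 2
    ∂(Measure.pi γ)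

theorem integrable_hellingerGibbs (hc0 : ∀ x, 0 ≤ c x) (hε : 0 < ε)
    (π : FiniteMeasure (∀ i, X i)) (f : ∀ i, Lp ℝ ∞ (γ i)) :
    Integrable (fun x => (√(((π : Measure (∀ i, X i)).rnDeriv (Measure.pi γ) x).toReal) -
      √(gibbs ε c f x)) ^ 2) (Measure.pi γ) := by
  have hpm : Measurable fun x => ((π : Measure (∀ i, X i)).rnDeriv (Measure.pi γ) x).toReal :=
    (Measure.measurable_rnDeriv _ _).ennreal_toReal
  have hgm := measurable_gibbs (ε := ε) (c := c) f
  have h1 : Integrable (fun x => ((π : Measure (∀ i, X i)).rnDeriv (Measure.pi γ) x).toReal)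
    (Measure.pi γ) := Measure.integrable_toReal_rnDeriv
  refine (h1.add (integrable_gibbs f hc0 hε)).mono' (by fun_prop) (ae_of_all _ fun x => ?_)
  have hp := ENNReal.toReal_nonneg (a := (π : Measure (∀ i, X i)).rnDeriv (Measure.pi γ) x)
  have hg := (gibbs_pos (ε := ε) (c := c) f x).le
  rw [Real.norm_eq_abs, abs_of_nonneg (sq_nonneg _), Pi.add_apply]
  nlinarith [Real.sq_sqrt hp, Real.sq_sqrt hg, mul_nonneg (Real.sqrt_nonneg
    ((π : Measure (∀ i, X i)).rnDeriv (Measure.pi γ) x).toReal) (Real.sqrt_nonneg (gibbs ε c f x))]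

variable [∀ i, CompactSpace (X i)] [∀ i, IsFiniteMeasure (μ i)]

/-- Weak duality, with the gap bounded below by the Hellinger distance to the Gibbs measure. -/
theorem dual_add_hellinger_le_primal (hφ : ∀ i, IsEntropyFunction (φ i)) (hμγ : ∀ i, μ i ≪ γ i)
    (hac : ∀ i, γ i ≪ μ i ∨ recession (φ i) = ∞) (hc0 : ∀ x, 0 ≤ c x) (hε : 0 < ε)
    (π : FiniteMeasure (∀ i, X i)) (f : ∀ i, Lp ℝ ∞ (γ i)) :
    dual ε c φ μ γ f + ((ε * hellingerGibbs ε c γ π f : ℝ) : EReal) ≤ primal ε c φ μ γ π := by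
  classical
  have h1 : ∀ i, φ i 1 = 0 := fun i => (hφ i).one
  by_cases hdual : dual ε c φ μ γ f = ⊥
  · rw [hdual, EReal.bot_add]; exact bot_le
  have hdf := (dual_ne_bot_iff h1 hμγ).1 hdual
  set P : Measure (∀ i, X i) := (π : Measure (∀ i, X i)) with hP
  set E : ℝ≥0∞ := ENNReal.ofReal ε * InformationTheory.klDiv P (Measure.pi γ) +
      ∑ i, divergence (φ i) (P.map (fun x => x i)) (μ i) with hE
  have hprimal : primal ε c φ μ γ π = ((∫ x, c x ∂P : ℝ) : EReal) + (E : EReal) := rfl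
  by_cases hEtop : E = ∞
  · rw [hprimal, hEtop, EReal.coe_ennreal_top, EReal.coe_add_top]; exact le_top
  obtain ⟨hK, hS⟩ := ENNReal.add_ne_top.1 hEtop
  have hkl : InformationTheory.klDiv P (Measure.pi γ) ≠ ∞ := by
    intro h
    rw [h, ENNReal.mul_top (ENNReal.ofReal_pos.2 hε).ne'] at hK
    exact hK rfl
  have hdiv : ∀ i, divergence (φ i) (P.map (fun x => x i)) (μ i) ≠ ∞ := fun i =>
    (ENNReal.sum_ne_top.1 hS) i (Finset.mem_univ i)
  have hPγ : P ≪ Measure.pi γ := (InformationTheory.klDiv_ne_top_iff.1 hkl).1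
  set p : (∀ i, X i) → ℝ := fun x => (P.rnDeriv (Measure.pi γ) x).toReal with hp
  have hpm : Measurable p := (Measure.measurable_rnDeriv _ _).ennreal_toReal
  have hp0 : ∀ x, 0 ≤ p x := fun x => ENNReal.toReal_nonneg
  have hpi : Integrable p (Measure.pi γ) := Measure.integrable_toReal_rnDeriv
  have hkm := InformationTheory.measurable_klFun
  have hkleq := InformationTheory.klDiv_eq_lintegral_klFun_of_ac hPγ
  have hki : Integrable (fun x => InformationTheory.klFun (p x)) (Measure.pi γ) := by
    refine ⟨(hkm.comp hpm).aestronglyMeasurable, ?_⟩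
    rw [hasFiniteIntegral_iff_ofReal (ae_of_all _ fun x => InformationTheory.klFun_nonneg (hp0 x)),
      ← hkleq]
    exact hkl.lt_top
  have hklreal : (InformationTheory.klDiv P (Measure.pi γ)).toReal =
      ∫ x, InformationTheory.klFun (p x) ∂(Measure.pi γ) := by
    rw [hkleq, integral_eq_lintegral_of_nonneg_ae
      (ae_of_all _ fun x => InformationTheory.klFun_nonneg (hp0 x))
      (hkm.comp hpm).aestronglyMeasurable]
  have hEreal : E.toReal = ε * ∫ x, InformationTheory.klFun (p x) ∂(Measure.pi γ) +
      ∑ i, (divergence (φ i) (P.map (fun x => x i)) (μ i)).toReal := by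
    rw [hE, ENNReal.toReal_add hK hS, ENNReal.toReal_mul, ENNReal.toReal_ofReal hε.le, hklreal,
      ENNReal.toReal_sum fun i _ => hdiv i]
  -- the marginal terms
  have hqmp : ∀ i, P.map (fun x => x i) ≪ γ i := fun i =>
    (hPγ.map (measurable_pi_apply i)).trans
      (Measure.quasiMeasurePreserving_eval γ i).absolutelyContinuous
  have hfb := ae_abs_le_norm_pi f
  have hfi : ∀ i, Integrable (fun x => f i (x i) * p x) (Measure.pi γ) := fun i =>
    hpi.bdd_mul ((measurable_coe_Lp (f i)).comp (measurable_pi_apply i)).aestronglyMeasurable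
      (hfb.mono fun x hx => hx i)
  have hmarg : ∀ i, 0 ≤ (divergence (φ i) (P.map (fun x => x i)) (μ i)).toReal +
      ∫ x, (conj (φ i) (-(f i x))).toReal ∂(μ i) + ∫ x, f i (x i) * p x ∂(Measure.pi γ) := by
    intro i
    have h := divergence_fenchel_young (hφ i) (hqmp i) (hac i) (hdiv i)
      (measurable_coe_Lp (f i)) (ae_abs_le_norm (f i)) (hdf i).1 (hdf i).2
    rw [integral_map (measurable_pi_apply i).aemeasurable
      (measurable_coe_Lp (f i)).aestronglyMeasurable, ← integral_toReal_rnDeriv_mul hPγ] at h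
    simpa only [mul_comm] using h
  have hci : Integrable (fun x => c x * p x) (Measure.pi γ) :=
    hpi.bdd_mul c.continuous.measurable.aestronglyMeasurable
      (ae_of_all _ fun x => c.norm_coe_le_norm x)
  have hcP : ∫ x, c x ∂P = ∫ x, c x * p x ∂(Measure.pi γ) := by
    rw [← integral_toReal_rnDeriv_mul hPγ]
    simp only [hp, mul_comm]
  have hgi := integrable_gibbs f hc0 hε
  -- the pointwise gap is `ε (p log p - p log g - p + g)` for the Gibbs density `g`
  have hgap : ε * hellingerGibbs ε c γ π f ≤ ∫ x, c x * p x ∂(Measure.pi γ) +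
      ε * ∫ x, InformationTheory.klFun (p x) ∂(Measure.pi γ) -
      ∑ i, ∫ x, f i (x i) * p x ∂(Measure.pi γ) +
      ε * ∫ x, (gibbs ε c f x - 1) ∂(Measure.pi γ) := by
    have i1 : Integrable (fun x => c x * p x + ε * InformationTheory.klFun (p x))
      (Measure.pi γ) := hci.add (hki.const_mul ε)
    have i2 : Integrable (fun x => ∑ i, f i (x i) * p x) (Measure.pi γ) :=
      integrable_finsetSum _ fun i _ => hfi i
    have i3 : Integrable (fun x => c x * p x + ε * InformationTheory.klFun (p x) -
      ∑ i, f i (x i) * p x) (Measure.pi γ) := i1.sub i2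
    have i4 : Integrable (fun x => ε * (gibbs ε c f x - 1)) (Measure.pi γ) :=
      (hgi.sub (integrable_const _)).const_mul ε
    rw [← integral_finsetSum _ fun i _ => hfi i, ← integral_const_mul, ← integral_const_mul,
      ← integral_add hci (hki.const_mul ε), ← integral_sub i1 i2, ← integral_add i3 i4,
      hellingerGibbs, ← integral_const_mul]
    refine integral_mono ((integrable_hellingerGibbs hc0 hε π f).const_mul ε) (i3.add i4)
      fun x => ?_
    have h := mul_le_mul_of_nonneg_left
      (sq_sqrt_sub_sqrt_le (hp0 x) (gibbs_pos (ε := ε) (c := c) f x)) hε.le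
    have hlog : ε * Real.log (gibbs ε c f x) = (∑ i, f i (x i)) - c x := by
      rw [gibbs, Real.log_exp]; field_simp
    simp only [InformationTheory.klFun]
    rw [← Finset.sum_mul]
    refine h.trans (le_of_eq ?_)
    linear_combination (-(p x)) * hlog
  rw [hdf.dual_eq h1, hprimal, ← EReal.coe_ennreal_toReal hEtop, ← EReal.coe_add, ← EReal.coe_add,
    EReal.coe_le_coe_iff, hEreal, hcP, dualReal]
  have hsum := Finset.sum_nonneg fun i (_ : i ∈ Finset.univ) => hmarg i
  rw [Finset.sum_add_distrib, Finset.sum_add_distrib] at hsum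
  linarith

end Weak

/-! ### Strong duality -/

section Separation

variable {N : ℕ} {X : Fin N → Type*} [∀ i, MeasurableSpace (X i)]
  {ε : ℝ} {c : (∀ i, X i) → ℝ} {φ : Fin N → ℝ → ℝ≥0∞} {μ γ : ∀ i, Measure (X i)}
  [∀ i, IsFiniteMeasure (γ i)]

/-- `z` is the density with respect to `γ` of the difference between the marginals of `p γ^⊗` and
the measures `r i μ i`. -/
def IsDefectDensity (μ γ : ∀ i, Measure (X i)) [∀ i, IsFiniteMeasure (γ i)]
    (z : ∀ i, Lp ℝ 1 (γ i)) (p : (∀ i, X i) → ℝ) (r : ∀ i, X i → ℝ) : Prop :=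
  ∀ (i : Fin N) (g : X i → ℝ) (C : ℝ), Measurable g → (∀ x, |g x| ≤ C) →
    ∫ x, g x * z i x ∂(γ i) = defect μ γ p r i g

/-- Both the marginals of `p γ^⊗` and the measures `r i μ i` are absolutely continuous with respect
to `γ i`, so the violation of the marginal constraints lives in `L¹(γ i)`. -/
theorem Admissible.exists_isDefectDensity [∀ i, IsFiniteMeasure (μ i)] (hμγ : ∀ i, μ i ≪ γ i)
    {p : (∀ i, X i) → ℝ} {r : ∀ i, X i → ℝ} (h : Admissible μ γ p r) :
    ∃ z : ∀ i, Lp ℝ 1 (γ i), IsDefectDensity μ γ z p r := by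
  classical
  let P : Measure (∀ i, X i) := (Measure.pi γ).withDensity fun x => ENNReal.ofReal (p x)
  have hPfin : IsFiniteMeasure P := isFiniteMeasure_withDensity_ofReal h.integrable.2
  have hPγ : P ≪ Measure.pi γ := withDensity_absolutelyContinuous _ _
  have hmap : ∀ i, P.map (fun x => x i) ≪ γ i := fun i =>
    (hPγ.map (measurable_pi_apply i)).trans
      (Measure.quasiMeasurePreserving_eval γ i).absolutelyContinuous
  have h1 : ∀ i, Integrable (fun x => ((P.map (fun x => x i)).rnDeriv (γ i) x).toReal) (γ i) :=
    fun i => Measure.integrable_toReal_rnDeriv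
  have h2 : ∀ i, Integrable (fun x => ((μ i).rnDeriv (γ i) x).toReal * r i x) (γ i) := fun i =>
    (integrable_rnDeriv_smul_iff (hμγ i)).2 (h.integrable_marginal i)
  refine ⟨fun i => ((h1 i).sub (h2 i)).toL1 _, fun i g C hg hgC => ?_⟩
  have e1 : ∫ x, ((P.map (fun x => x i)).rnDeriv (γ i) x).toReal * g x ∂(γ i) =
      ∫ x, g (x i) * p x ∂(Measure.pi γ) := by
    rw [integral_toReal_rnDeriv_mul (hmap i), integral_map (measurable_pi_apply i).aemeasurable
      hg.aestronglyMeasurable, integral_withDensity_eq_integral_toReal_smul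
        h.measurable.ennreal_ofReal (ae_of_all _ fun x => ENNReal.ofReal_lt_top)]
    refine integral_congr_ae (ae_of_all _ fun x => ?_)
    simp only [smul_eq_mul]
    rw [ENNReal.toReal_ofReal (h.nonneg x), mul_comm]
  have e2 : ∫ x, ((μ i).rnDeriv (γ i) x).toReal * (g x * r i x) ∂(γ i) =
      ∫ x, g x * r i x ∂(μ i) := integral_toReal_rnDeriv_mul (hμγ i)
  rw [defect, ← e1, ← e2, ← integral_sub]
  · refine integral_congr_ae ?_
    filter_upwards [Integrable.coeFn_toL1 ((h1 i).sub (h2 i))] with x hx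
    rw [hx, Pi.sub_apply]
    ring
  · exact (h1 i).mul_bdd hg.aestronglyMeasurable (ae_of_all _ hgC)
  · exact (integrable_rnDeriv_smul_iff (hμγ i)).2 (h.integrable_marginal_mul i hg hgC)

/-- The Hahn–Banach step: a lower bound for the decoupled objective under a small violation of the
marginal constraints produces bounded multipliers. -/
theorem exists_multipliers [∀ i, IsFiniteMeasure (μ i)] (hμγ : ∀ i, μ i ≪ γ i)
    (hφ : ∀ i, IsEntropyFunction (φ i)) (hc : Measurable c) (hc0 : ∀ x, 0 ≤ c x) (hε : 0 < ε)
    {α δ : ℝ} (hδ : 0 < δ)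
    (h : ∀ p r, Admissible μ γ p r → DefectLE μ γ δ p r → cost ε c φ μ γ p r ≠ ∞ →
      α ≤ (cost ε c φ μ γ p r).toReal) :
    ∃ (g : ∀ i, X i → ℝ) (C : ℝ), (∀ i, Measurable (g i)) ∧ (∀ i x, |g i x| ≤ C) ∧
      ∀ p r, Admissible μ γ p r → cost ε c φ μ γ p r ≠ ∞ →
        α ≤ (cost ε c φ μ γ p r).toReal + ∑ i, defect μ γ p r i (g i) := by
  classical
  let S : Set ((∀ i, Lp ℝ 1 (γ i)) × ℝ) := {e | ∃ p r, Admissible μ γ p r ∧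
    IsDefectDensity μ γ e.1 p r ∧ cost ε c φ μ γ p r ≠ ∞ ∧ (cost ε c φ μ γ p r).toReal ≤ e.2}
  have hS : Convex ℝ S := by
    rintro ⟨z, t⟩ ⟨p, r, h1, h2, h3, h4⟩ ⟨w, u⟩ ⟨q, s, k1, k2, k3, k4⟩ a b ha hb hab
    have hle : cost ε c φ μ γ (fun x => a * p x + b * q x) (fun i x => a * r i x + b * s i x) ≤
        ENNReal.ofReal a * cost ε c φ μ γ p r + ENNReal.ofReal b * cost ε c φ μ γ q s :=
      le_self_add.trans (h1.cost_combo k1 hφ hc hc0 hε ha hb hab)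
    have ht1 := ENNReal.mul_ne_top (ENNReal.ofReal_ne_top (r := a)) h3
    have ht2 := ENNReal.mul_ne_top (ENNReal.ofReal_ne_top (r := b)) k3
    have htop := ENNReal.add_ne_top.2 ⟨ht1, ht2⟩
    refine ⟨_, _, h1.combo k1 ha hb, fun i g C hg hgC => ?_, ne_top_of_le_ne_top htop hle, ?_⟩
    · rw [h1.defect_combo k1 i hg hgC, ← h2 i g C hg hgC, ← k2 i g C hg hgC,
        ← integral_const_mul, ← integral_const_mul, ← integral_add]
      · refine integral_congr_ae ?_
        filter_upwards [Lp.coeFn_add (a • z i) (b • w i), Lp.coeFn_smul a (z i),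
          Lp.coeFn_smul b (w i)] with x e1 e2 e3
        change g x * (a • z i + b • w i : Lp ℝ 1 (γ i)) x = _
        rw [e1, Pi.add_apply, e2, e3, Pi.smul_apply, Pi.smul_apply, smul_eq_mul, smul_eq_mul]
        ring
      · exact ((L1.integrable_coeFn (z i)).bdd_mul hg.aestronglyMeasurable
          (ae_of_all _ hgC)).const_mul a
      · exact ((L1.integrable_coeFn (w i)).bdd_mul hg.aestronglyMeasurable
          (ae_of_all _ hgC)).const_mul b
    · refine (ENNReal.toReal_mono htop hle).trans ?_
      rw [ENNReal.toReal_add ht1 ht2, ENNReal.toReal_mul, ENNReal.toReal_mul,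
        ENNReal.toReal_ofReal ha, ENNReal.toReal_ofReal hb]
      exact add_le_add (mul_le_mul_of_nonneg_left h4 ha) (mul_le_mul_of_nonneg_left k4 hb)
  have hdisj : Disjoint (Metric.ball (0 : ∀ i, Lp ℝ 1 (γ i)) δ ×ˢ Iio α) S := by
    rw [Set.disjoint_left]
    rintro ⟨z, t⟩ ⟨hz, ht⟩ ⟨p, r, h1, h2, h3, h4⟩
    refine absurd (h p r h1 (fun i g hg hg1 => ?_) h3) (not_le.2 (h4.trans_lt ht))
    rw [← h2 i g 1 hg hg1]
    have hzi : ‖z i‖ ≤ δ := (norm_le_pi_norm z i).trans (mem_ball_zero_iff.1 hz).le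
    refine le_trans ?_ hzi
    rw [L1.norm_eq_integral_norm, ← Real.norm_eq_abs]
    refine norm_integral_le_of_norm_le (L1.integrable_coeFn (z i)).norm (ae_of_all _ fun x => ?_)
    rw [norm_mul]
    exact mul_le_of_le_one_left (norm_nonneg _) (hg1 x)
  obtain ⟨F, u, hF1, hF2⟩ := geometric_hahn_banach_open
    ((convex_ball _ _).prod (convex_Iio α)) (Metric.isOpen_ball.prod isOpen_Iio) hS hdisj
  let ℓ : ∀ i, Lp ℝ 1 (γ i) →L[ℝ] ℝ := fun i =>
    (F.comp (ContinuousLinearMap.inl ℝ (∀ i, Lp ℝ 1 (γ i)) ℝ)).comp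
      (ContinuousLinearMap.single ℝ (fun i => Lp ℝ 1 (γ i)) i)
  set s : ℝ := F (0, 1) with hs
  have hF : ∀ z t, F (z, t) = ∑ i, ℓ i (z i) + s * t := by
    intro z t
    have h1 : (z, t) = ContinuousLinearMap.inl ℝ (∀ i, Lp ℝ 1 (γ i)) ℝ z +
        t • ((0 : ∀ i, Lp ℝ 1 (γ i)), (1 : ℝ)) := by
      simp
    rw [h1, map_add, map_smul, smul_eq_mul, mul_comm, hs]
    congr 1
    have h2 : z = ∑ i, ContinuousLinearMap.single ℝ (fun i => Lp ℝ 1 (γ i)) i (z i) :=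
      (Finset.univ_sum_single z).symm
    conv_lhs => rw [h2]
    rw [map_sum, map_sum]
    rfl
  have hst : ∀ t < α, s * t < u := fun t ht => by
    have := hF1 (0, t) ⟨Metric.mem_ball_self hδ, ht⟩
    rw [hF] at this
    simpa using this
  -- the multiplier `k` normalizes the separating functional; `s = 0` is a vertical hyperplane
  obtain ⟨k, hk⟩ : ∃ k : ℝ, ∀ (z : ∀ i, Lp ℝ 1 (γ i)) (J : ℝ), 0 ≤ J → (z, J) ∈ S →
      α ≤ J + k * ∑ i, ℓ i (z i) := by
    rcases lt_trichotomy s 0 with hs0 | hs0 | hs0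
    · exfalso
      have h1 := hst (min (α - 1) (u / s)) ((min_le_left _ _).trans_lt (by linarith))
      have h2 : s * (u / s) ≤ s * min (α - 1) (u / s) :=
        mul_le_mul_of_nonpos_left (min_le_right _ _) hs0.le
      rw [mul_div_cancel₀ _ hs0.ne] at h2
      linarith
    · have hu : 0 < u := by
        have := hst (α - 1) (by linarith)
        rwa [hs0, zero_mul] at this
      refine ⟨|α| / u, fun z J hJ hz => ?_⟩
      have h1 := hF2 _ hz
      rw [hF, hs0, zero_mul, add_zero] at h1
      have h2 := mul_le_mul_of_nonneg_left h1 (div_nonneg (abs_nonneg α) hu.le)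
      rw [div_mul_cancel₀ _ hu.ne'] at h2
      linarith [le_abs_self α]
    · have hu : s * α ≤ u := by
        have ht : Tendsto (fun n : ℕ => s * (α - 1 / ((n : ℝ) + 1))) atTop
            (nhds (s * (α - 0))) :=
          (tendsto_const_nhds.sub tendsto_one_div_add_atTop_nhds_zero_nat).const_mul s
        rw [sub_zero] at ht
        exact le_of_tendsto' ht fun n =>
          (hst _ (sub_lt_self _ Nat.one_div_pos_of_nat)).le
      refine ⟨s⁻¹, fun z J _ hz => ?_⟩
      have h1 := hu.trans (hF2 _ hz)
      rw [hF] at h1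
      have h2 := mul_le_mul_of_nonneg_left h1 (inv_nonneg.2 hs0.le)
      rw [inv_mul_cancel_left₀ hs0.ne', mul_add, inv_mul_cancel_left₀ hs0.ne'] at h2
      linarith
  choose g₀ hg₀m hg₀b hg₀ using fun i => exists_bounded_repr_L1 (ℓ i)
  have hbd : ∀ i x, |k * g₀ i x| ≤ |k| * ∑ j, ‖ℓ j‖ := fun i x => by
    rw [abs_mul]
    exact mul_le_mul_of_nonneg_left ((hg₀b i x).trans
      (Finset.single_le_sum (f := fun j => ‖ℓ j‖) (fun j _ => norm_nonneg _)
        (Finset.mem_univ i))) (abs_nonneg k)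
  refine ⟨fun i x => k * g₀ i x, |k| * ∑ j, ‖ℓ j‖, fun i => (hg₀m i).const_mul k, hbd,
    fun p r hpr hcost => ?_⟩
  obtain ⟨z, hz⟩ := hpr.exists_isDefectDensity hμγ
  refine (hk z _ ENNReal.toReal_nonneg ⟨p, r, hpr, hz, hcost, le_rfl⟩).trans (le_of_eq ?_)
  rw [Finset.mul_sum]
  congr 1
  refine Finset.sum_congr rfl fun i _ => ?_
  rw [← hz i _ _ ((hg₀m i).const_mul k) (hbd i), hg₀ i, ← integral_const_mul]
  simp only [mul_assoc]

end Separation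

section StrongDuality

variable {N : ℕ} {X : Fin N → Type*} [∀ i, TopologicalSpace (X i)] [∀ i, CompactSpace (X i)]
  [∀ i, PolishSpace (X i)] [∀ i, MeasurableSpace (X i)] [∀ i, BorelSpace (X i)]
  {ε : ℝ} {c : C(∀ i, X i, ℝ)} {φ : Fin N → ℝ → ℝ≥0∞} {μ γ : ∀ i, Measure (X i)}
  [∀ i, IsFiniteMeasure (μ i)] [∀ i, IsFiniteMeasure (γ i)]

/-- Below the primal value, the decoupled objective is bounded from below also for slightly
infeasible pairs. -/
theorem exists_relaxation_of_lt_value (hφ : ∀ i, IsEntropyFunction (φ i)) (hc0 : ∀ x, 0 ≤ c x)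
    (hε : 0 < ε) {α : ℝ} (hα : (α : EReal) < value ε c φ μ γ) :
    ∃ δ > 0, ∀ p r, Admissible μ γ p r → DefectLE μ γ δ p r → cost ε c φ μ γ p r ≠ ∞ →
      α ≤ (cost ε c φ μ γ p r).toReal := by
  by_contra! hcon
  have hα0 : 0 ≤ α := by
    obtain ⟨p, r, -, -, -, h⟩ := hcon 1 one_pos
    exact ENNReal.toReal_nonneg.trans h.le
  obtain ⟨p, r, h1, h2, h3⟩ := exists_feasible_of_relaxed hφ c.continuous.measurable hc0 hε
    (ENNReal.ofReal_ne_top (r := α)) fun δ hδ => by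
      obtain ⟨p, r, h1, h2, h3, h4⟩ := hcon δ hδ
      exact ⟨p, r, h1, h2, (ENNReal.le_ofReal_iff_toReal_le h3 hα0).2 h4.le⟩
  obtain ⟨π, hπ⟩ := h1.exists_primal_eq (φ := φ) h2 hc0 hε
  refine absurd hα (not_lt.2 ((iInf_le _ π).trans ?_))
  rw [hπ]
  refine (EReal.coe_ennreal_le_coe_ennreal_iff.2 h3).trans (le_of_eq ?_)
  rw [EReal.coe_ennreal_ofReal, max_eq_left hα0]

/-- Bounded multipliers for the marginal constraints give a point where the dual functional is
large: the Lagrangian is minimized in `p` by the Gibbs density, and in `r` by near-maximizers in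
the definition of the conjugates. -/
theorem exists_le_dual_of_multipliers (hμγ : ∀ i, μ i ≪ γ i)
    (hφ : ∀ i, IsEntropyFunction (φ i)) (hc0 : ∀ x, 0 ≤ c x) (hε : 0 < ε) {α C : ℝ}
    {g : ∀ i, X i → ℝ} (hg : ∀ i, Measurable (g i)) (hgC : ∀ i x, |g i x| ≤ C)
    (h : ∀ p r, Admissible μ γ p r → cost ε c φ μ γ p r ≠ ∞ →
        α ≤ (cost ε c φ μ γ p r).toReal + ∑ i, defect μ γ p r i (g i)) :
    ∃ f : ∀ i, Lp ℝ ∞ (γ i), (α : EReal) ≤ dual ε c φ μ γ f := by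
  classical
  have hcm : Measurable c := c.continuous.measurable
  have hk := InformationTheory.measurable_klFun
  have hmem : ∀ i, MemLp (fun x => -(g i x)) ∞ (γ i) := fun i =>
    memLp_top_of_bound (hg i).neg.aestronglyMeasurable C
      (ae_of_all _ fun x => by rw [norm_neg]; exact hgC i x)
  let f : ∀ i, Lp ℝ ∞ (γ i) := fun i => (hmem i).toLp _
  have hfg : ∀ i, f i =ᵐ[γ i] fun x => -(g i x) := fun i => (hmem i).coeFn_toLp
  have hfgμ : ∀ i, ∀ᵐ x ∂(μ i), -(f i x) = g i x := fun i => by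
    filter_upwards [(hμγ i).ae_le (hfg i)] with x hx
    rw [hx, neg_neg]
  -- the Gibbs density
  let p : (∀ i, X i) → ℝ := fun x => Real.exp (((∑ i, -(g i (x i))) - c x) / ε)
  have hgm : ∀ i, Measurable fun x : ∀ i, X i => g i (x i) := fun i =>
    (hg i).comp (measurable_pi_apply i)
  have hpm : Measurable p := by fun_prop
  have hp0 : ∀ x, 0 ≤ p x := fun x => (Real.exp_pos _).le
  have hpgibbs : p =ᵐ[Measure.pi γ] gibbs ε c f := by
    have : ∀ᵐ x ∂(Measure.pi γ), ∀ i, f i (x i) = -(g i (x i)) :=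
      ae_all_iff.2 fun i => (Measure.quasiMeasurePreserving_eval γ i).ae (hfg i)
    filter_upwards [this] with x hx
    simp only [p, gibbs, hx]
  have hpi : Integrable p (Measure.pi γ) := (integrable_gibbs f hc0 hε).congr hpgibbs.symm
  have hlog : ∀ x, ε * Real.log (p x) = (∑ i, -(g i (x i))) - c x := fun x => by
    simp only [p]
    rw [Real.log_exp]; field_simp
  have hgpi : ∀ i, Integrable (fun x : ∀ i, X i => g i (x i) * p x) (Measure.pi γ) := fun i =>
    hpi.bdd_mul (hgm i).aestronglyMeasurable (ae_of_all _ fun x => hgC i (x i))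
  have hkeq : ∀ x, c x * p x + ε * InformationTheory.klFun (p x) =
      ε * (1 - p x) - ∑ i, g i (x i) * p x := fun x => by
    have h1 := hlog x
    rw [Finset.sum_neg_distrib] at h1
    simp only [InformationTheory.klFun]
    rw [← Finset.sum_mul]
    linear_combination (p x) * h1
  have hcost0 : ∀ x, 0 ≤ c x * p x + ε * InformationTheory.klFun (p x) := fun x =>
    add_nonneg (mul_nonneg (hc0 x) (hp0 x))
      (mul_nonneg hε.le (InformationTheory.klFun_nonneg (hp0 x)))
  have i1 : Integrable (fun x => ε * (1 - p x)) (Measure.pi γ) :=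
    ((integrable_const _).sub hpi).const_mul ε
  have i2 : Integrable (fun x => ∑ i, g i (x i) * p x) (Measure.pi γ) :=
    integrable_finsetSum _ fun i _ => hgpi i
  have i3 : Integrable (fun x => c x * p x + ε * InformationTheory.klFun (p x)) (Measure.pi γ) := by
    simp only [hkeq]
    exact i1.sub i2
  choose R hRm hRfin hRtop hR0 hRmono hRge hRsup using fun i => exists_selection (hφ i)
  let V : ℕ → ∀ i, X i → ℝ := fun n i x => g i x * R i n (g i x) - (φ i (R i n (g i x))).toReal
  let r : ℕ → ∀ i, X i → ℝ := fun n i x => R i n (g i x)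
  have hrm : ∀ n i, Measurable (r n i) := fun n i => (hRm i n).comp (hg i)
  have hφm : ∀ n i, Measurable fun x => φ i (r n i x) := fun n i =>
    ((hφ i).lsc.measurable).comp (hrm n i)
  have hVm : ∀ n i, Measurable (V n i) := fun n i =>
    ((hg i).mul (hrm n i)).sub (hφm n i).ennreal_toReal
  have hrB : ∀ n i, ∃ B, ∀ x, r n i x ≤ B ∧ (φ i (r n i x)).toReal ≤ B := by
    intro n i
    obtain ⟨B₁, hB₁⟩ := (hRfin i n).bddAbove
    obtain ⟨B₂, hB₂⟩ := ((hRfin i n).image fun y => (φ i y).toReal).bddAbove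
    exact ⟨max B₁ B₂, fun x => ⟨(hB₁ ⟨_, rfl⟩).trans (le_max_left _ _),
      (hB₂ ⟨_, ⟨_, rfl⟩, rfl⟩).trans (le_max_right _ _)⟩⟩
  have hri : ∀ n i, Integrable (r n i) (μ i) := fun n i => by
    obtain ⟨B, hB⟩ := hrB n i
    refine Integrable.of_bound (hrm n i).aestronglyMeasurable B (ae_of_all _ fun x => ?_)
    rw [Real.norm_eq_abs, abs_of_nonneg (hR0 i n _)]
    exact (hB x).1
  have hφi : ∀ n i, Integrable (fun x => (φ i (r n i x)).toReal) (μ i) := fun n i => by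
    obtain ⟨B, hB⟩ := hrB n i
    refine Integrable.of_bound (hφm n i).ennreal_toReal.aestronglyMeasurable B
      (ae_of_all _ fun x => ?_)
    rw [Real.norm_eq_abs, abs_of_nonneg ENNReal.toReal_nonneg]
    exact (hB x).2
  have hadm : ∀ n, Admissible μ γ p (r n) := fun n =>
    ⟨hpm, hp0, hpi, hrm n, fun i x => hR0 i n _, hri n⟩
  have hgri : ∀ n i, Integrable (fun x => g i x * r n i x) (μ i) := fun n i =>
    (hadm n).integrable_marginal_mul i (hg i) (hgC i)
  have hVi : ∀ n i, Integrable (V n i) (μ i) := fun n i => (hgri n i).sub (hφi n i)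
  have hlφ : ∀ n i, ∫⁻ x, φ i (r n i x) ∂(μ i) =
      ENNReal.ofReal (∫ x, (φ i (r n i x)).toReal ∂(μ i)) := fun n i => by
    rw [ofReal_integral_eq_lintegral_ofReal (hφi n i) (ae_of_all _ fun x => ENNReal.toReal_nonneg)]
    exact lintegral_congr fun x => (ENNReal.ofReal_toReal (hRtop i n _)).symm
  -- the Lagrangian bound at the Gibbs density and the `n`-th near-maximizers
  have hbound : ∀ n, ∑ i, ∫ x, V n i x ∂(μ i) ≤ -α - ε * ∫ x, (p x - 1) ∂(Measure.pi γ) := by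
    intro n
    have hcost : cost ε c φ μ γ p (r n) =
        ENNReal.ofReal (∫ x, (c x * p x + ε * InformationTheory.klFun (p x)) ∂(Measure.pi γ)) +
          ∑ i, ENNReal.ofReal (∫ x, (φ i (r n i x)).toReal ∂(μ i)) := by
      rw [cost, ofReal_integral_eq_lintegral_ofReal i3 (ae_of_all _ hcost0)]
      simp only [hlφ]
    have hsum_top : ∑ i, ENNReal.ofReal (∫ x, (φ i (r n i x)).toReal ∂(μ i)) ≠ ∞ :=
      ENNReal.sum_ne_top.2 fun i _ => ENNReal.ofReal_ne_top
    have h1 := h p (r n) (hadm n) (by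
      rw [hcost]; exact ENNReal.add_ne_top.2 ⟨ENNReal.ofReal_ne_top, hsum_top⟩)
    rw [hcost, ENNReal.toReal_add ENNReal.ofReal_ne_top hsum_top,
      ENNReal.toReal_ofReal (integral_nonneg hcost0),
      ENNReal.toReal_sum fun i _ => ENNReal.ofReal_ne_top] at h1
    have h2 : ∀ i, (ENNReal.ofReal (∫ x, (φ i (r n i x)).toReal ∂(μ i))).toReal =
        ∫ x, (φ i (r n i x)).toReal ∂(μ i) := fun i =>
      ENNReal.toReal_ofReal (integral_nonneg fun x => ENNReal.toReal_nonneg)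
    have h3 : ∫ x, (c x * p x + ε * InformationTheory.klFun (p x)) ∂(Measure.pi γ) =
        -(ε * ∫ x, (p x - 1) ∂(Measure.pi γ)) -
          ∑ i, ∫ x, g i (x i) * p x ∂(Measure.pi γ) := by
      simp only [hkeq]
      rw [integral_sub i1 i2, integral_finsetSum _ fun i _ => hgpi i, integral_const_mul,
        ← mul_neg, ← integral_neg]
      simp only [neg_sub]
    have h4 : ∀ i, ∫ x, V n i x ∂(μ i) = ∫ x, g i x * r n i x ∂(μ i) -
        ∫ x, (φ i (r n i x)).toReal ∂(μ i) := fun i => integral_sub (hgri n i) (hφi n i)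
    simp only [h2, h3, defect, Finset.sum_sub_distrib] at h1
    simp only [h4, Finset.sum_sub_distrib]
    linarith
  have hVge : ∀ n i, ∫ x, g i x ∂(μ i) ≤ ∫ x, V n i x ∂(μ i) := fun n i =>
    integral_mono (Integrable.of_bound (hg i).aestronglyMeasurable C (ae_of_all _ (hgC i)))
      (hVi n i) fun x => hRge i n (g i x)
  have hVle : ∀ i n, ∫ x, V n i x ∂(μ i) ≤ -α - ε * ∫ x, (p x - 1) ∂(Measure.pi γ) -
      ∑ j ∈ Finset.univ.erase i, ∫ x, g j x ∂(μ j) := fun i n => by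
    have h1 := hbound n
    rw [← Finset.add_sum_erase _ _ (Finset.mem_univ i)] at h1
    have h2 := Finset.sum_le_sum fun j (_ : j ∈ Finset.univ.erase i) => hVge n j
    linarith
  have hlim := fun i => tendsto_integral_eintegral (ν := μ i)
    (g := fun x => conj (φ i) (-(f i x))) (V := fun n => V n i) (fun n => hVm n i)
    (fun n => hVi n i) (ae_of_all _ fun x => hRmono i (g i x)) (hVle i)
    (by
      filter_upwards [hfgμ i] with x hx
      rw [hx]; exact hRsup i (g i x))
    ((measurable_conj (hφ i).one).comp (measurable_coe_Lp (f i)).neg)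
  refine ⟨f, ?_⟩
  have h1 : ∀ i, φ i 1 = 0 := fun i => (hφ i).one
  have hneg : ∀ i, ∫⁻ x, (-(conj (φ i) (-(f i x)))).toENNReal ∂(μ i) ≠ ∞ := fun i =>
    lintegral_neg_conj_ne_top (h1 i) ((hμγ i).ae_le (ae_abs_le_norm (f i)))
  have hfin : DualFinite φ μ f := fun i => by
    have := integrable_of_eintegral_ne_top
      ((measurable_conj (h1 i)).comp (measurable_coe_Lp (f i)).neg) (hneg i) (hlim i).2
    exact ⟨this.1.mono fun x hx => hx.1, this.2⟩
  have hlimR : ∀ i, Tendsto (fun n => ∫ x, V n i x ∂(μ i)) atTop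
      (nhds (∫ x, (conj (φ i) (-(f i x))).toReal ∂(μ i))) := fun i => by
    have := (hlim i).1
    rw [eintegral_eq_integral ((hfin i).1.mono fun x hx => ⟨hx, conj_ne_bot (h1 i) _⟩)
      (hfin i).2] at this
    exact EReal.tendsto_coe.1 this
  rw [hfin.dual_eq h1, EReal.coe_le_coe_iff, dualReal]
  have h2 := le_of_tendsto' (tendsto_finsetSum Finset.univ fun i _ => hlimR i) hbound
  have h3 : ∫ x, (p x - 1) ∂(Measure.pi γ) = ∫ x, (gibbs ε c f x - 1) ∂(Measure.pi γ) :=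
    integral_congr_ae (hpgibbs.mono fun x hx => by simp only [hx])
  rw [h3] at h2
  linarith

/-- The nontrivial half of strong duality. It needs no condition on the recession constants: those
only enter in weak duality. -/
theorem value_le_iSup_dual (hμγ : ∀ i, μ i ≪ γ i) (hφ : ∀ i, IsEntropyFunction (φ i))
    (hc0 : ∀ x, 0 ≤ c x) (hε : 0 < ε) :
    value ε c φ μ γ ≤ ⨆ f : (∀ i, Lp ℝ ∞ (γ i)), dual ε c φ μ γ f := by
  refine le_of_forall_lt fun d hd => ?_
  obtain ⟨α, hdα, hα⟩ := EReal.lt_iff_exists_real_btwn.1 hd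
  obtain ⟨δ, hδ, h⟩ := exists_relaxation_of_lt_value hφ hc0 hε hα
  obtain ⟨g, C, hg, hgC, h'⟩ :=
    exists_multipliers hμγ hφ c.continuous.measurable hc0 hε hδ h
  obtain ⟨f, hf⟩ := exists_le_dual_of_multipliers hμγ hφ hc0 hε hg hgC h'
  exact hdα.trans_le (hf.trans (le_iSup (dual ε c φ μ γ) f))

end StrongDuality

/-! ### Strict concavity of the dual functional -/

section StrictConcavity

theorem integral_lt_of_ae_le {Y : Type*} [MeasurableSpace Y] {ν : Measure Y} {f g : Y → ℝ}
    (hf : Integrable f ν) (hg : Integrable g ν) (hle : f ≤ᵐ[ν] g)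
    (hlt : ¬ ∀ᵐ y ∂ν, g y ≤ f y) : ∫ y, f y ∂ν < ∫ y, g y ∂ν :=
  (integral_mono_ae hf hg hle).lt_of_ne fun h =>
    hlt (((integral_eq_iff_of_ae_le hf hg hle).1 h).mono fun _ hy => hy.ge)

theorem pi_preimage_eval {N : ℕ} {X : Fin N → Type*} [∀ i, MeasurableSpace (X i)]
    (γ : ∀ i, Measure (X i)) [∀ i, IsFiniteMeasure (γ i)] (i : Fin N) {s : Set (X i)}
    (hs : MeasurableSet s) :
    Measure.pi γ ((fun x => x i) ⁻¹' s) = (∏ j ∈ Finset.univ.erase i, γ j univ) * γ i s := by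
  have h := congrArg (fun m => m s) (Measure.pi_map_eval γ i)
  simpa [Measure.map_apply (measurable_pi_apply i) hs] using h

/-- Absolute continuity of product measures passes to the factors, as no factor of the first product
vanishes. -/
theorem absolutelyContinuous_of_pi {N : ℕ} {X : Fin N → Type*} [∀ i, MeasurableSpace (X i)]
    {μ γ : ∀ i, Measure (X i)} [∀ i, IsFiniteMeasure (μ i)] [∀ i, IsFiniteMeasure (γ i)]
    (hμ0 : ∀ i, μ i univ ≠ 0) (h : Measure.pi μ ≪ Measure.pi γ) (i : Fin N) : μ i ≪ γ i := by
  refine Measure.AbsolutelyContinuous.mk fun s hs h0 => ?_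
  have h1 : Measure.pi γ ((fun x => x i) ⁻¹' s) = 0 := by
    rw [pi_preimage_eval γ i hs, h0, mul_zero]
  have h2 := h h1
  rw [pi_preimage_eval μ i hs] at h2
  exact (mul_eq_zero.1 h2).resolve_left (Finset.prod_ne_zero_iff.2 fun j _ => hμ0 j)

theorem coeFn_combo {N : ℕ} {X : Fin N → Type*} [∀ i, MeasurableSpace (X i)]
    {γ : ∀ i, Measure (X i)} (f g : ∀ i, Lp ℝ ∞ (γ i)) (a b : ℝ) (i : Fin N) :
    ∀ᵐ x ∂(γ i), (a • f + b • g) i x = a * f i x + b * g i x := by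
  filter_upwards [Lp.coeFn_add (a • f i) (b • g i), Lp.coeFn_smul a (f i),
    Lp.coeFn_smul b (g i)] with x h1 h2 h3
  change (a • f i + b • g i : Lp ℝ ∞ (γ i)) x = _
  rw [h1, Pi.add_apply, h2, h3]
  rfl

variable {N : ℕ} {X : Fin N → Type*} [∀ i, MeasurableSpace (X i)]
  {ε : ℝ} {φ : Fin N → ℝ → ℝ≥0∞} {μ γ : ∀ i, Measure (X i)}
  {f g : ∀ i, Lp ℝ ∞ (γ i)} {a b : ℝ}

/-- Convexity of the conjugates along the segment from `f` to `g`. It holds only almost everywhere,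
since elements of `L^∞` are evaluated through representatives. -/
theorem conj_combo_ae (hφ : ∀ i, StrictlyConvex (conj (φ i))) (hμγ : ∀ i, μ i ≪ γ i)
    (hf : DualFinite φ μ f) (hg : DualFinite φ μ g) (ha : 0 ≤ a) (hb : 0 ≤ b) (hab : a + b = 1)
    (i : Fin N) : ∀ᵐ x ∂(μ i), conj (φ i) (-((a • f + b • g) i x)) ≠ ⊤ ∧
      (conj (φ i) (-((a • f + b • g) i x))).toReal ≤
        a * (conj (φ i) (-(f i x))).toReal + b * (conj (φ i) (-(g i x))).toReal := by
  filter_upwards [(hμγ i).ae_le (coeFn_combo f g a b i), (hf i).1, (hg i).1] with x h1 h2 h3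
  have e : -((a • f + b • g) i x) = a • (-(f i x)) + b • (-(g i x)) := by
    rw [h1, smul_eq_mul, smul_eq_mul]; ring
  rw [e]
  exact ⟨(hφ i).1 h2 h3 ha hb hab, (hφ i).convexOn.2 h2 h3 ha hb hab⟩

theorem DualFinite.combo [∀ i, IsFiniteMeasure (μ i)] (h1 : ∀ i, φ i 1 = 0)
    (hφ : ∀ i, StrictlyConvex (conj (φ i)))
    (hμγ : ∀ i, μ i ≪ γ i) (hf : DualFinite φ μ f) (hg : DualFinite φ μ g) (ha : 0 ≤ a)
    (hb : 0 ≤ b) (hab : a + b = 1) : DualFinite φ μ (a • f + b • g) := by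
  intro i
  have h := conj_combo_ae hφ hμγ hf hg ha hb hab i
  have hm : Measurable fun x => conj (φ i) (-((a • f + b • g) i x)) :=
    (measurable_conj (h1 i)).comp (measurable_coe_Lp ((a • f + b • g) i)).neg
  refine ⟨h.mono fun x hx => hx.1, ?_⟩
  refine (((((hf i).2.const_mul a).add ((hg i).2.const_mul b)).abs).add
    (integrable_const ‖(a • f + b • g) i‖)).mono' hm.ereal_toReal.aestronglyMeasurable ?_
  filter_upwards [h, (hμγ i).ae_le (ae_abs_le_norm ((a • f + b • g) i))] with x hx hn
  have hlow : -((a • f + b • g) i x) ≤ (conj (φ i) (-((a • f + b • g) i x))).toReal := by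
    have := le_conj (h1 i) (-((a • f + b • g) i x))
    rwa [← EReal.coe_toReal hx.1 (conj_ne_bot (h1 i) _), EReal.coe_le_coe_iff] at this
  have hA := abs_nonneg
    (a * (conj (φ i) (-(f i x))).toReal + b * (conj (φ i) (-(g i x))).toReal)
  rw [Real.norm_eq_abs]
  refine abs_le.2 ⟨(neg_le_neg ((abs_le.1 hn).2.trans (le_add_of_nonneg_left hA))).trans hlow, ?_⟩
  exact (hx.2.trans (le_abs_self _)).trans (le_add_of_nonneg_right (norm_nonneg _))

/-- If `f i = g i` holds `μ i`-almost everywhere for all `i` but `f ≠ g`, then `f^⊕` and `g^⊕`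
differ on a set of positive `γ^⊗`-measure: a box with one side `{f i ≠ g i}` and the other sides
`{f j = g j}`. -/
theorem measure_sum_ne_pos [∀ i, IsFiniteMeasure (γ i)] (hμ0 : ∀ i, μ i univ ≠ 0)
    (hμγ : ∀ i, μ i ≪ γ i) (hne : f ≠ g) (heq : ∀ j, f j =ᵐ[μ j] g j) :
    Measure.pi γ {x | ∑ i, f i (x i) ≠ ∑ i, g i (x i)} ≠ 0 := by
  classical
  obtain ⟨i, hi⟩ := Function.ne_iff.1 hne
  let A : ∀ j, Set (X j) := fun j => if j = i then {x | f j x ≠ g j x} else {x | f j x = g j x}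
  have hA : ∀ j, γ j (A j) ≠ 0 := by
    intro j
    by_cases hj : j = i
    · subst hj
      simp only [A, if_true]
      exact fun h0 => hi (Lp.ext (ae_iff.2 h0))
    · simp only [A, if_neg hj]
      intro h0
      refine hμ0 j ?_
      have h2 : μ j ({x | f j x = g j x} ∪ {x | ¬ f j x = g j x}) = 0 :=
        measure_union_null (hμγ j h0) (ae_iff.1 (heq j))
      rwa [← compl_ofPred, union_compl_self] at h2
  have hsub : Set.pi univ A ⊆ {x | ∑ i, f i (x i) ≠ ∑ i, g i (x i)} := by
    intro x hx
    have h1 : ∀ j ∈ Finset.univ.erase i, f j (x j) = g j (x j) := fun j hj => by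
      have := hx j (mem_univ j)
      simpa only [A, if_neg (Finset.ne_of_mem_erase hj), mem_ofPred_eq] using this
    have h2 : f i (x i) ≠ g i (x i) := by
      have := hx i (mem_univ i)
      simpa only [A, if_true, mem_ofPred_eq] using this
    simp only [mem_ofPred_eq]
    rw [← Finset.add_sum_erase _ _ (Finset.mem_univ i),
      ← Finset.add_sum_erase _ (fun j => g j (x j)) (Finset.mem_univ i),
      Finset.sum_congr rfl h1]
    exact fun h => h2 (add_right_cancel h)
  intro h0
  have := measure_mono_null hsub h0
  rw [Measure.pi_pi] at this
  obtain ⟨j, -, hj⟩ := Finset.prod_eq_zero_iff.1 this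
  exact hA j hj

variable [∀ i, TopologicalSpace (X i)] {c : C(∀ i, X i, ℝ)} [∀ i, IsFiniteMeasure (γ i)]

theorem gibbs_combo_ae (f g : ∀ i, Lp ℝ ∞ (γ i)) (hε : 0 < ε) (ha : 0 < a) (hb : 0 < b)
    (hab : a + b = 1) :
    ∀ᵐ x ∂(Measure.pi γ),
      gibbs ε c (a • f + b • g) x ≤ a * gibbs ε c f x + b * gibbs ε c g x ∧
      (∑ i, f i (x i) ≠ ∑ i, g i (x i) →
        gibbs ε c (a • f + b • g) x < a * gibbs ε c f x + b * gibbs ε c g x) := by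
  have : ∀ᵐ x ∂(Measure.pi γ), ∀ i, (a • f + b • g) i (x i) = a * f i (x i) + b * g i (x i) :=
    ae_all_iff.2 fun i => (Measure.quasiMeasurePreserving_eval γ i).ae (coeFn_combo f g a b i)
  filter_upwards [this] with x hx
  have e : (∑ i, (a • f + b • g) i (x i) - c x) / ε =
      a • ((∑ i, f i (x i) - c x) / ε) + b • ((∑ i, g i (x i) - c x) / ε) := by
    have hcx : c x = a * c x + b * c x := by rw [← add_mul, hab, one_mul]
    simp only [hx, Finset.sum_add_distrib, ← Finset.mul_sum, smul_eq_mul]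
    field_simp
    linarith
  simp only [gibbs, e]
  refine ⟨convexOn_exp.2 (mem_univ _) (mem_univ _) ha.le hb.le hab, fun hne => ?_⟩
  refine strictConvexOn_exp.2 (mem_univ _) (mem_univ _) (fun h => hne ?_) ha hb hab
  rw [div_left_inj' hε.ne'] at h
  linarith

/-- Strict concavity of the dual functional comes from the conjugates where the potentials differ
on a set charged by some `μ i`, and from the exponential otherwise. -/
theorem strictConcaveOn_dual [∀ i, PolishSpace (X i)] [∀ i, BorelSpace (X i)]
    [∀ i, IsFiniteMeasure (μ i)] (h1 : ∀ i, φ i 1 = 0)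
    (hφ : ∀ i, StrictlyConvex (conj (φ i))) (hμ0 : ∀ i, μ i univ ≠ 0) (hμγ : ∀ i, μ i ≪ γ i)
    (hc0 : ∀ x, 0 ≤ c x) (hε : 0 < ε) :
    StrictConcaveOn ℝ {f : (∀ i, Lp ℝ ∞ (γ i)) | dual ε c φ μ γ f ≠ ⊥}
      (fun f => (dual ε c φ μ γ f).toReal) := by
  constructor
  · intro f hf g hg a b ha hb hab
    exact (dual_ne_bot_iff h1 hμγ).2 (((dual_ne_bot_iff h1 hμγ).1 hf).combo h1 hφ hμγ
      ((dual_ne_bot_iff h1 hμγ).1 hg) ha hb hab)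
  intro f hf' g hg' hne a b ha hb hab
  have hf := (dual_ne_bot_iff h1 hμγ).1 hf'
  have hg := (dual_ne_bot_iff h1 hμγ).1 hg'
  have hh := hf.combo h1 hφ hμγ hg ha.le hb.le hab
  simp only
  rw [hf.dual_eq h1, hg.dual_eq h1, hh.dual_eq h1, EReal.toReal_coe, EReal.toReal_coe,
    EReal.toReal_coe, smul_eq_mul, smul_eq_mul]
  set h : ∀ i, Lp ℝ ∞ (γ i) := a • f + b • g with hdef
  have gf := integrable_gibbs f hc0 hε
  have gg := integrable_gibbs g hc0 hε
  have gh := integrable_gibbs h hc0 hε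
  have icomb : ∀ i, Integrable (fun x => a * (conj (φ i) (-(f i x))).toReal +
      b * (conj (φ i) (-(g i x))).toReal) (μ i) := fun i =>
    ((hf i).2.const_mul a).add ((hg i).2.const_mul b)
  have gcomb : Integrable (fun x => a * gibbs ε c f x + b * gibbs ε c g x) (Measure.pi γ) :=
    (gf.const_mul a).add (gg.const_mul b)
  have ecomb : ∀ i, ∫ x, (a * (conj (φ i) (-(f i x))).toReal +
      b * (conj (φ i) (-(g i x))).toReal) ∂(μ i) =
      a * ∫ x, (conj (φ i) (-(f i x))).toReal ∂(μ i) +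
        b * ∫ x, (conj (φ i) (-(g i x))).toReal ∂(μ i) := fun i => by
    rw [integral_add ((hf i).2.const_mul a) ((hg i).2.const_mul b), integral_const_mul,
      integral_const_mul]
  have egcomb : ∫ x, (a * gibbs ε c f x + b * gibbs ε c g x) ∂(Measure.pi γ) =
      a * ∫ x, gibbs ε c f x ∂(Measure.pi γ) + b * ∫ x, gibbs ε c g x ∂(Measure.pi γ) := by
    rw [integral_add (gf.const_mul a) (gg.const_mul b), integral_const_mul, integral_const_mul]
  have hconj := conj_combo_ae hφ hμγ hf hg ha.le hb.le hab
  have hgib := gibbs_combo_ae (c := c) f g hε ha hb hab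
  have hle : ∀ i, ∫ x, (conj (φ i) (-(h i x))).toReal ∂(μ i) ≤
      a * ∫ x, (conj (φ i) (-(f i x))).toReal ∂(μ i) +
        b * ∫ x, (conj (φ i) (-(g i x))).toReal ∂(μ i) := fun i => by
    rw [← ecomb i]
    exact integral_mono_ae (hh i).2 (icomb i) ((hconj i).mono fun x hx => hx.2)
  have hgle : ∫ x, gibbs ε c h x ∂(Measure.pi γ) ≤
      a * ∫ x, gibbs ε c f x ∂(Measure.pi γ) + b * ∫ x, gibbs ε c g x ∂(Measure.pi γ) := by
    rw [← egcomb]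
    exact integral_mono_ae gh gcomb (hgib.mono fun x hx => hx.1)
  -- it remains to find one strict inequality
  suffices hstrict : ∑ i, ∫ x, (conj (φ i) (-(h i x))).toReal ∂(μ i) +
      ε * ∫ x, gibbs ε c h x ∂(Measure.pi γ) <
      ∑ i, (a * ∫ x, (conj (φ i) (-(f i x))).toReal ∂(μ i) +
        b * ∫ x, (conj (φ i) (-(g i x))).toReal ∂(μ i)) +
      ε * (a * ∫ x, gibbs ε c f x ∂(Measure.pi γ) + b * ∫ x, gibbs ε c g x ∂(Measure.pi γ)) by
    rw [Finset.sum_add_distrib, ← Finset.mul_sum, ← Finset.mul_sum] at hstrict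
    have hone : ∀ k : ∀ i, Lp ℝ ∞ (γ i), ∫ x, (gibbs ε c k x - 1) ∂(Measure.pi γ) =
        ∫ x, gibbs ε c k x ∂(Measure.pi γ) - (Measure.pi γ).real univ := fun k => by
      rw [integral_sub (integrable_gibbs k hc0 hε) (integrable_const _)]
      simp
    simp only [dualReal, hone]
    obtain rfl : b = 1 - a := by linarith
    nlinarith
  by_cases hcase : ∀ j, f j =ᵐ[μ j] g j
  · refine add_lt_add_of_le_of_lt (Finset.sum_le_sum fun i _ => hle i)
      (mul_lt_mul_of_pos_left ?_ hε)
    rw [← egcomb]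
    refine integral_lt_of_ae_le gh gcomb
      (hgib.mono fun x hx => hx.1) fun h0 => ?_
    refine measure_sum_ne_pos hμ0 hμγ hne hcase ?_
    change ∀ᵐ x ∂(Measure.pi γ), ∑ i, f i (x i) = ∑ i, g i (x i)
    filter_upwards [hgib, h0] with x h2 h3
    by_contra h4
    exact not_lt.2 h3 (h2.2 h4)
  · obtain ⟨j, hj⟩ := not_forall.1 hcase
    refine add_lt_add_of_lt_of_le (Finset.sum_lt_sum (fun i _ => hle i)
      ⟨j, Finset.mem_univ j, ?_⟩) (mul_le_mul_of_nonneg_left hgle hε.le)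
    rw [← ecomb j]
    refine integral_lt_of_ae_le (hh j).2 (icomb j)
      ((hconj j).mono fun x hx => hx.2) fun h0 => hj ?_
    filter_upwards [(hμγ j).ae_le (coeFn_combo f g a b j), (hf j).1, (hg j).1, h0]
      with x h2 h3 h4 h5
    by_contra h6
    refine not_lt.2 h5 ?_
    have e : -(h j x) = a • (-(f j x)) + b • (-(g j x)) := by
      rw [hdef, h2, smul_eq_mul, smul_eq_mul]; ring
    rw [e]
    exact (hφ j).2 h3 h4 (fun h7 => h6 (neg_injective h7)) ha hb hab

end StrictConcavity

/-! ### Optimality -/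

section Optimality

theorem conj_zero {φ : ℝ → ℝ≥0∞} (h1 : φ 1 = 0) : conj φ 0 = 0 := by
  refine le_antisymm (iSup_le fun x => ?_) (by simpa using le_conj h1 0)
  rw [zero_mul, EReal.coe_zero, zero_sub, EReal.neg_le, neg_zero]
  exact EReal.coe_ennreal_nonneg _

theorem dualFinite_zero {N : ℕ} {X : Fin N → Type*} [∀ i, MeasurableSpace (X i)]
    {φ : Fin N → ℝ → ℝ≥0∞} {μ γ : ∀ i, Measure (X i)} (h1 : ∀ i, φ i 1 = 0) (hμγ : ∀ i, μ i ≪ γ i) :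
    DualFinite φ μ (0 : ∀ i, Lp ℝ ∞ (γ i)) := by
  intro i
  have h0 : ∀ᵐ x ∂(μ i), conj (φ i) (-((0 : ∀ i, Lp ℝ ∞ (γ i)) i x)) = 0 := by
    filter_upwards [(hμγ i).ae_le (Lp.coeFn_zero ℝ ∞ (γ i))] with x hx
    rw [Pi.zero_apply, hx, Pi.zero_apply, neg_zero, conj_zero (h1 i)]
  refine ⟨h0.mono fun x hx => by rw [hx]; exact EReal.zero_ne_top, ?_⟩
  refine (integrable_zero _ ℝ (μ i)).congr (h0.mono fun x hx => ?_)
  simp only [Pi.zero_apply] at hx ⊢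
  rw [hx, EReal.toReal_zero]

variable {N : ℕ} {X : Fin N → Type*} [∀ i, TopologicalSpace (X i)] [∀ i, MeasurableSpace (X i)]
  {ε : ℝ} {c : C(∀ i, X i, ℝ)} {φ : Fin N → ℝ → ℝ≥0∞} {μ γ : ∀ i, Measure (X i)}
  [∀ i, IsFiniteMeasure (γ i)]

theorem absolutelyContinuous_of_primal_ne_top (hε : 0 < ε) {π : FiniteMeasure (∀ i, X i)}
    (h : primal ε c φ μ γ π ≠ ⊤) : (π : Measure (∀ i, X i)) ≪ Measure.pi γ := by
  by_contra hac
  refine h ?_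
  rw [primal, InformationTheory.klDiv_of_not_ac hac,
    ENNReal.mul_top (ENNReal.ofReal_pos.2 hε).ne', top_add, EReal.coe_ennreal_top,
    EReal.coe_add_top]

variable [∀ i, IsFiniteMeasure (μ i)]

variable [∀ i, PolishSpace (X i)] [∀ i, BorelSpace (X i)]

/-- If the dual functional has a maximizer, then `γ i ≪ μ i`: on a `μ i`-null set charged by
`γ i` the potential could be lowered, decreasing only the exponential term. -/
theorem absolutelyContinuous_of_isMax (h1 : ∀ i, φ i 1 = 0) (hγ0 : ∀ i, γ i univ ≠ 0)
    (hμγ : ∀ i, μ i ≪ γ i) (hc0 : ∀ x, 0 ≤ c x) (hε : 0 < ε) {f : ∀ i, Lp ℝ ∞ (γ i)}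
    (hmax : ∀ g : (∀ i, Lp ℝ ∞ (γ i)), dual ε c φ μ γ g ≤ dual ε c φ μ γ f) (i : Fin N) :
    γ i ≪ μ i := by
  classical
  refine Measure.AbsolutelyContinuous.mk fun A hA hμA => ?_
  by_contra hγA
  have hbot : dual ε c φ μ γ f ≠ ⊥ := by
    have h0 := (dual_ne_bot_iff (ε := ε) (c := c) h1 hμγ).2 (dualFinite_zero h1 hμγ)
    exact ((bot_lt_iff_ne_bot.2 h0).trans_le (hmax 0)).ne'
  have hf := (dual_ne_bot_iff h1 hμγ).1 hbot
  let u : Lp ℝ ∞ (γ i) := indicatorConstLp ∞ hA (measure_ne_top _ _) 1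
  let g : ∀ j, Lp ℝ ∞ (γ j) := Function.update f i (f i - u)
  have hu : ∀ᵐ x ∂(γ i), g i x = f i x - A.indicator (fun _ => (1 : ℝ)) x := by
    filter_upwards [Lp.coeFn_sub (f i) u, indicatorConstLp_coeFn (p := ∞) (hs := hA)
      (hμs := measure_ne_top (γ i) A) (c := (1 : ℝ))] with x h2 h3
    rw [show g i = f i - u from Function.update_self _ _ _, h2, Pi.sub_apply, h3]
  have hgj : ∀ j, j ≠ i → g j = f j := fun j hj => Function.update_of_ne hj _ _
  have hgμ : ∀ j, ∀ᵐ x ∂(μ j), g j x = f j x := by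
    intro j
    by_cases hj : j = i
    · subst hj
      have hAc : ∀ᵐ x ∂(μ j), x ∉ A := by
        rw [ae_iff]
        simpa using hμA
      filter_upwards [(hμγ j).ae_le hu, hAc] with x h2 h3
      rw [h2, indicator_of_notMem h3, sub_zero]
    · rw [hgj j hj]
      exact ae_of_all _ fun x => rfl
  have hg : DualFinite φ μ g := fun j => by
    refine ⟨?_, (hf j).2.congr ((hgμ j).mono fun x hx => by simp only [hx])⟩
    filter_upwards [(hf j).1, hgμ j] with x h2 h3
    rwa [h3]
  have hconj : ∀ j, ∫ x, (conj (φ j) (-(g j x))).toReal ∂(μ j) =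
      ∫ x, (conj (φ j) (-(f j x))).toReal ∂(μ j) := fun j =>
    integral_congr_ae ((hgμ j).mono fun x hx => by simp only [hx])
  have hsum : ∀ᵐ x ∂(Measure.pi γ), ∑ j, g j (x j) =
      ∑ j, f j (x j) - A.indicator (fun _ => (1 : ℝ)) (x i) := by
    filter_upwards [(Measure.quasiMeasurePreserving_eval γ i).ae hu] with x hx
    rw [← Finset.add_sum_erase _ _ (Finset.mem_univ i),
      ← Finset.add_sum_erase _ (fun j => f j (x j)) (Finset.mem_univ i), hx,
      Finset.sum_congr rfl fun j hj => by rw [hgj j (Finset.ne_of_mem_erase hj)]]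
    ring
  have hlt : ∫ x, gibbs ε c g x ∂(Measure.pi γ) < ∫ x, gibbs ε c f x ∂(Measure.pi γ) := by
    refine integral_lt_of_ae_le (integrable_gibbs g hc0 hε)
      (integrable_gibbs f hc0 hε) ?_ ?_
    · filter_upwards [hsum] with x hx
      refine Real.exp_le_exp.2 (div_le_div_of_nonneg_right ?_ hε.le)
      have : 0 ≤ A.indicator (fun _ => (1 : ℝ)) (x i) := indicator_nonneg (fun _ _ => one_pos.le) _
      linarith
    · intro h0
      have h2 : Measure.pi γ ((fun x => x i) ⁻¹' A) = 0 := by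
        have h3 : ∀ᵐ x ∂(Measure.pi γ), ¬ x i ∈ A := by
          filter_upwards [hsum, h0] with x h3 h4 h5
          refine not_lt.2 h4 (Real.exp_lt_exp.2 (div_lt_div_of_pos_right ?_ hε))
          rw [h3, indicator_of_mem h5]
          linarith
        exact measure_eq_zero_iff_ae_notMem.2 h3
      rw [pi_preimage_eval γ i hA] at h2
      rcases mul_eq_zero.1 h2 with h3 | h3
      · exact Finset.prod_ne_zero_iff.2 (fun j _ => hγ0 j) h3
      · exact hγA h3
  have h2 := hmax g
  rw [hf.dual_eq h1, hg.dual_eq h1, EReal.coe_le_coe_iff, dualReal, dualReal,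
    integral_sub (integrable_gibbs g hc0 hε) (integrable_const _),
    integral_sub (integrable_gibbs f hc0 hε) (integrable_const _)] at h2
  simp only [hconj] at h2
  nlinarith

variable [∀ i, CompactSpace (X i)]

/-- If the Hellinger distance between `π ≪ γ^⊗` and the Gibbs measure of `f` vanishes, the two
coincide. -/
theorem eq_withDensity_of_hellingerGibbs_nonpos (hc0 : ∀ x, 0 ≤ c x) (hε : 0 < ε)
    {π : FiniteMeasure (∀ i, X i)} {f : ∀ i, Lp ℝ ∞ (γ i)}
    (hπ : (π : Measure (∀ i, X i)) ≪ Measure.pi γ) (h : hellingerGibbs ε c γ π f ≤ 0) :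
    (π : Measure (∀ i, X i)) =
      (Measure.pi γ).withDensity (fun x => ENNReal.ofReal (gibbs ε c f x)) := by
  have h0 : hellingerGibbs ε c γ π f = 0 := le_antisymm h (integral_nonneg fun x => sq_nonneg _)
  rw [hellingerGibbs, integral_eq_zero_iff_of_nonneg (fun x => sq_nonneg _)
    (integrable_hellingerGibbs hc0 hε π f)] at h0
  rw [← Measure.withDensity_rnDeriv_eq _ _ hπ]
  refine withDensity_congr_ae ?_
  filter_upwards [h0, Measure.rnDeriv_ne_top (π : Measure (∀ i, X i)) (Measure.pi γ)] with x h1 h2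
  have h3 := sub_eq_zero.1 (pow_eq_zero_iff two_ne_zero |>.1 h1)
  rw [Real.sqrt_inj ENNReal.toReal_nonneg (gibbs_pos f x).le] at h3
  rw [← h3, ENNReal.ofReal_toReal h2]

theorem value_eq_iSup_dual (hφ : ∀ i, IsEntropyFunction (φ i)) (hμγ : ∀ i, μ i ≪ γ i)
    (hac : ∀ i, γ i ≪ μ i ∨ recession (φ i) = ∞) (hc0 : ∀ x, 0 ≤ c x) (hε : 0 < ε) :
    value ε c φ μ γ = ⨆ f : (∀ i, Lp ℝ ∞ (γ i)), dual ε c φ μ γ f := by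
  refine le_antisymm (value_le_iSup_dual hμγ hφ hc0 hε)
    (iSup_le fun f => le_iInf fun π => ?_)
  refine le_trans ?_ (dual_add_hellinger_le_primal hφ hμγ hac hc0 hε π f)
  refine le_add_of_nonneg_right (EReal.coe_nonneg.2 (mul_nonneg hε.le ?_))
  exact integral_nonneg fun x => sq_nonneg _

end Optimality

end UMOT

theorem mainTheorem2 {N : ℕ} {X : Fin N → Type*}
    [∀ i, TopologicalSpace (X i)] [∀ i, CompactSpace (X i)] [∀ i, PolishSpace (X i)]
    [∀ i, Nonempty (X i)] [∀ i, MeasurableSpace (X i)] [∀ i, BorelSpace (X i)]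
    (μ γ : ∀ i, Measure (X i)) [∀ i, IsFiniteMeasure (μ i)] [∀ i, IsFiniteMeasure (γ i)]
    [∀ i, (μ i).IsOpenPosMeasure]
    (hKL : InformationTheory.klDiv (Measure.pi μ) (Measure.pi γ) < ∞)
    (c : C(∀ i, X i, ℝ)) (hc : ∀ x, 0 ≤ c x)
    (φ : Fin N → ℝ → ℝ≥0∞) (hφ : ∀ i, UMOT.IsEntropyFunction (φ i))
    (ε : ℝ) (hε : 0 < ε) :
    ((∀ i, γ i ≪ μ i ∨ UMOT.recession (φ i) = ∞) →
      UMOT.value ε c φ μ γ = ⨆ f : (∀ i, Lp ℝ ∞ (γ i)), UMOT.dual ε c φ μ γ f) ∧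
    ((∀ i, UMOT.StrictlyConvex (UMOT.conj (φ i))) →
      StrictConcaveOn ℝ {f : (∀ i, Lp ℝ ∞ (γ i)) | UMOT.dual ε c φ μ γ f ≠ ⊥}
        (fun f => (UMOT.dual ε c φ μ γ f).toReal)) ∧
    (∀ (π : FiniteMeasure (∀ i, X i)) (f : ∀ i, Lp ℝ ∞ (γ i)),
      (∀ π' : FiniteMeasure (∀ i, X i), UMOT.primal ε c φ μ γ π ≤ UMOT.primal ε c φ μ γ π') →
      (∀ g : (∀ i, Lp ℝ ∞ (γ i)), UMOT.dual ε c φ μ γ g ≤ UMOT.dual ε c φ μ γ f) →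
      (π : Measure (∀ i, X i)) =
        (Measure.pi γ).withDensity (fun x => ENNReal.ofReal (UMOT.gibbs ε c f x))) := by
  have h1 : ∀ i, φ i 1 = 0 := fun i => (hφ i).one
  have hμ0 : ∀ i, μ i univ ≠ 0 := fun i => isOpen_univ.measure_ne_zero _ univ_nonempty
  have hμγ : ∀ i, μ i ≪ γ i :=
    UMOT.absolutelyContinuous_of_pi hμ0 (InformationTheory.klDiv_ne_top_iff.1 hKL.ne).1
  have hγ0 : ∀ i, γ i univ ≠ 0 := fun i h => hμ0 i (hμγ i h)
  refine ⟨fun hac => UMOT.value_eq_iSup_dual hφ hμγ hac hc hε,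
    fun hconj => UMOT.strictConcaveOn_dual h1 hconj hμ0 hμγ hc hε, fun π f hπ hf => ?_⟩
  -- the existence of the maximizer `f` supplies the condition for strong duality
  have hac : ∀ i, γ i ≪ μ i ∨ UMOT.recession (φ i) = ∞ := fun i =>
    Or.inl (UMOT.absolutelyContinuous_of_isMax h1 hγ0 hμγ hc hε hf i)
  have hbot : UMOT.dual ε c φ μ γ f ≠ ⊥ := by
    have h0 := (UMOT.dual_ne_bot_iff (ε := ε) (c := c) h1 hμγ).2 (UMOT.dualFinite_zero h1 hμγ)
    exact ((bot_lt_iff_ne_bot.2 h0).trans_le (hf 0)).ne'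
  have hdual := ((UMOT.dual_ne_bot_iff h1 hμγ).1 hbot).dual_eq (ε := ε) (c := c) h1
  have hle : UMOT.primal ε c φ μ γ π ≤ UMOT.dual ε c φ μ γ f :=
    (le_iInf hπ).trans ((UMOT.value_eq_iSup_dual hφ hμγ hac hc hε).le.trans (iSup_le hf))
  have htop : UMOT.primal ε c φ μ γ π ≠ ⊤ :=
    ne_top_of_le_ne_top (UMOT.dual_ne_top h1 hμγ f) hle
  have hgap := (UMOT.dual_add_hellinger_le_primal hφ hμγ hac hc hε π f).trans hle
  rw [hdual, ← EReal.coe_add, EReal.coe_le_coe_iff] at hgap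
  refine UMOT.eq_withDensity_of_hellingerGibbs_nonpos hc hε
    (UMOT.absolutelyContinuous_of_primal_ne_top hε htop) ?_
  by_contra hpos
  linarith [mul_pos hε (not_le.1 hpos)]
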